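/- Let $\mathcal X\subset\mathbb R^d$, and for $\varepsilon>0$ let $\mathcal N(\mathcal X,\|\cdot\|_\infty,\varepsilon)$ be the smallest cardinality of a set $S\subset\mathcal X$ such that every point of $\mathcal X$ has sup-norm distance at most $\varepsilon$ from some point of $S$. Assume that there are constants $C_{\mathcal X}\ge 1$ and $\varrho>0$ such that $$\mathcal N(\mathcal X,\|\cdot\|_\infty,\varepsilon)\le C_{\mathcal X}\,\varepsilon^{-\varrho}\qquad\text{for all }\varepsilon\in(0,1].$$ Let $P_{\mathcal X}$ be a Borel probability measure on $\mathcal X$, let $\sigma\in(0,1]$, and let $\mathcal H_{K^\sigma}(\mathcal X^2)$ be the reproducing kernel Hilbert space on $\mathcal X^2=\mathcal X\times\mathcal X$ of the pairwise Gaussian kernel $$K^\sigma((x,x'),(u,u'))=\tfrac12\exp\Big(-\frac{\|(x,x')-(u,u')\|_2^2}{\sigma^2}\Big)-\tfrac12\exp\Big(-\frac{\|(x',x)-(u,u')\|_2^2}{\sigma^2}\Big).$$ For a measure $\mu$ on $\mathcal X^2$ and $i\ge1$ let $e_i(\mathrm{id}:\mathcal H_{K^\sigma}(\mathcal X^2)\to\mathcal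 L_2(\mu))$ be the infimum of all $\varepsilon>0$ such that the closed unit ball of $\mathcal H_{K^\sigma}(\mathcal X^2)$ is covered by $2^{i-1}$ closed $\mathcal L_2(\mu)$-balls of radius $\varepsilon$ with centres in that unit ball. Then for every $p\in(0,1/2)$ the space $\mathcal H_{K^\sigma}(\mathcal X^2)$ satisfies the capacity condition with $p_1=p_2=p$ and $a_1=a_2=a$, where $$a:=\big(C^*_{\mathcal X}\,p^{-2d-1}\sigma^{-2\varrho}\big)^{\frac1{2p}},\qquad C^*_{\mathcal X}:=12\,C_{\mathcal X}^2\binom{4e+2d}{2d}\frac{(2d+1)^{2d+1}}{2^{2d+1}e^{4d+1}},\qquad \binom{t}{k}:=\frac{t(t-1)\cdots(t-k+1)}{k!}.$$ That is, $a>0$, and for all points $X_1,\dots,X_n\in\mathcal X$ (in particular for every realization of an i.i.d. sample of $P_{\mathcal X}$), every $f\in\mathcal H_{K^\sigma}(\mathcal X^2)$ is square-integrable with respect to the measures below, and for all $i\ge 1$ $$e_i\Big(\mathrm{id}:\mathcal H_{K^\sigma}(\mathcal X^2)\to\mathcal L_2\Big(\frac1n\sum_{j=1}^n\delta_{X_j}\otimes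 P_{\mathcal X}\Big)\Big)\le a\,i^{-\frac1{2p}}\qquad(n\ge1),$$ $$e_i\Big(\mathrm{id}:\mathcal H_{K^\sigma}(\mathcal X^2)\to\mathcal L_2\Big(\frac1{n(n-1)}\sum_{j\ne k}\delta_{(X_j,X_k)}\Big)\Big)\le a\,i^{-\frac1{2p}}\qquad(n\ge2).$$ -/

import Mathlib

open MeasureTheory Set
open scoped ENNReal NNReal

namespace PairwiseRanking

noncomputable section

/-! ### Entropy numbers -/

/-- The `i`-th (dyadic) entropy number of a set `T` with respect to a pseudo-distance `dist`:
the infimum of all `ε > 0` such that `T` is covered by `2 ^ (i - 1)` closed balls of radius `ε`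
with centres in `T`. It is meant for `i ≥ 1`, and it is `∞` if no such `ε` exists. -/
def entropyNumber {α : Type*} (T : Set α) (dist : α → α → ℝ≥0∞) (i : ℕ) : ℝ≥0∞ :=
  ⨅ (ε : ℝ≥0) (_ : 0 < ε ∧ ∃ s : Fin (2 ^ (i - 1)) → α,
    (∀ j, s j ∈ T) ∧ ∀ t ∈ T, ∃ j, dist t (s j) ≤ ε), (ε : ℝ≥0∞)

section Capacity

variable {Ω : Type*}

/-- The `i`-th entropy number of the map `id : H → L₂(μ)`, for a reproducing kernel Hilbert space
`H` of real functions on `Ω`: the entropy number of the closed unit ball of `H`, as a set of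
functions, for the `L₂(μ)`-seminorm. -/
def entropyNumberId (H : Type*) [NormedAddCommGroup H] [InnerProductSpace ℝ H] [RKHS ℝ H Ω ℝ]
    [MeasurableSpace Ω] (μ : Measure Ω) (i : ℕ) : ℝ≥0∞ :=
  entropyNumber ((fun f : H => (f : Ω → ℝ)) '' Metric.closedBall (0 : H) 1)
    (fun f g => eLpNorm (f - g) 2 μ) i

/-- The empirical measure `(1 / n) ∑ i, δ_{x i}`. -/
def empiricalMeasure [MeasurableSpace Ω] {n : ℕ} (x : Fin n → Ω) : Measure Ω :=
  (n : ℝ≥0∞)⁻¹ • ∑ i, Measure.dirac (x i)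

/-- The empirical measure `(1 / (n (n - 1))) ∑_{i ≠ j} δ_{(x i, x j)}` of the pairs. -/
def empiricalPairMeasure [MeasurableSpace Ω] {n : ℕ} (x : Fin n → Ω) : Measure (Ω × Ω) :=
  ((n * (n - 1) : ℕ) : ℝ≥0∞)⁻¹ • ∑ i, ∑ j ∈ Finset.univ.erase i, Measure.dirac (x i, x j)

/-- The capacity condition, with exponents `p₁, p₂` and constants `a₁, a₂`, on a reproducing kernel
Hilbert space `H` of functions on `Ω × Ω`, where `P` is the distribution of the data on `Ω`.
The bounds hold for every sample size and for all sample points. -/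
structure CapacityCondition (H : Type*) [NormedAddCommGroup H] [InnerProductSpace ℝ H]
    [RKHS ℝ H (Ω × Ω) ℝ] [MeasurableSpace Ω] (P : Measure Ω) (p₁ p₂ a₁ a₂ : ℝ) : Prop where
  p₁_mem : p₁ ∈ Ioo (0 : ℝ) (1 / 2)
  p₂_mem : p₂ ∈ Ioo (0 : ℝ) (1 / 2)
  a₁_pos : 0 < a₁
  a₂_pos : 0 < a₂
  -- the two embeddings `id : H → L₂` are well defined
  memLp_prod : ∀ n : ℕ, 1 ≤ n → ∀ (x : Fin n → Ω) (f : H),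
    MemLp (f : Ω × Ω → ℝ) 2 ((empiricalMeasure x).prod P)
  memLp_pair : ∀ n : ℕ, 2 ≤ n → ∀ (x : Fin n → Ω) (f : H),
    MemLp (f : Ω × Ω → ℝ) 2 (empiricalPairMeasure x)
  entropy_prod : ∀ n : ℕ, 1 ≤ n → ∀ (x : Fin n → Ω) (i : ℕ), 1 ≤ i →
    entropyNumberId H ((empiricalMeasure x).prod P) i
      ≤ ENNReal.ofReal (a₁ * (i : ℝ) ^ (-(1 / (2 * p₁))))
  entropy_pair : ∀ n : ℕ, 2 ≤ n → ∀ (x : Fin n → Ω) (i : ℕ), 1 ≤ i →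
    entropyNumberId H (empiricalPairMeasure x) i
      ≤ ENNReal.ofReal (a₂ * (i : ℝ) ^ (-(1 / (2 * p₂))))

end Capacity

/-! ### The pairwise Gaussian kernel and its reproducing kernel Hilbert space -/

section Kernel

variable {d : ℕ}

/-- The squared Euclidean distance of two points `z = (x, x')`, `w = (u, u')` of `ℝᵈ × ℝᵈ`. -/
def sqDist (z w : (Fin d → ℝ) × (Fin d → ℝ)) : ℝ :=
  ∑ k, (z.1 k - w.1 k) ^ 2 + ∑ k, (z.2 k - w.2 k) ^ 2

/-- The pairwise Gaussian kernel on `ℝᵈ × ℝᵈ`. -/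
def pairwiseGaussian (σ : ℝ) (z w : (Fin d → ℝ) × (Fin d → ℝ)) : ℝ :=
  1 / 2 * Real.exp (-(sqDist z w / σ ^ 2)) - 1 / 2 * Real.exp (-(sqDist z.swap w / σ ^ 2))

/-- The feature map `z ↦ (√2 / σ) z` into the Euclidean space `ℝ²ᵈ`; it is only used to prove that
the pairwise Gaussian kernel is positive semidefinite. -/
def feat (σ : ℝ) (z : (Fin d → ℝ) × (Fin d → ℝ)) : EuclideanSpace ℝ (Fin d ⊕ Fin d) :=
  (√2 / σ) • WithLp.toLp 2 (Sum.elim z.1 z.2)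

lemma norm_feat_sub (σ : ℝ) (z w : (Fin d → ℝ) × (Fin d → ℝ)) :
    ‖feat σ z - feat σ w‖ ^ 2 / 2 = sqDist z w / σ ^ 2 := by
  rw [feat, feat, ← smul_sub, norm_smul, mul_pow, EuclideanSpace.norm_sq_eq]
  simp [Fintype.sum_sum_type, sqDist, div_pow]
  ring

open ProbabilityTheory Complex ComplexConjugate in
lemma exp_sqDist_eq (σ : ℝ) (z w : (Fin d → ℝ) × (Fin d → ℝ)) :
    (Real.exp (-(sqDist z w / σ ^ 2)) : ℂ) =
      ∫ x, cexp (inner ℝ x (feat σ z) * I) * conj (cexp (inner ℝ x (feat σ w) * I))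
        ∂(stdGaussian (EuclideanSpace ℝ (Fin d ⊕ Fin d))) := by
  rw [← norm_feat_sub]
  have h := charFun_stdGaussian (feat σ z - feat σ w)
  rw [charFun_apply] at h
  push_cast
  rw [← neg_div, ← h]
  refine integral_congr_ae (.of_forall fun x => ?_)
  simp only [← Complex.exp_conj, ← Complex.exp_add, inner_sub_right, map_mul, conj_ofReal, conj_I]
  congr 1
  push_cast
  ring

lemma sqDist_comm (z w : (Fin d → ℝ) × (Fin d → ℝ)) : sqDist z w = sqDist w z := by
  simp only [sqDist, sub_sq_comm]

lemma sqDist_swap_swap (z w : (Fin d → ℝ) × (Fin d → ℝ)) :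
    sqDist z.swap w.swap = sqDist z w := by
  simp only [sqDist, Prod.fst_swap, Prod.snd_swap]
  ring

lemma sqDist_swap_left (z w : (Fin d → ℝ) × (Fin d → ℝ)) :
    sqDist z.swap w = sqDist z w.swap := by
  rw [← sqDist_swap_swap, Prod.swap_swap]

lemma pairwiseGaussian_comm (σ : ℝ) (z w : (Fin d → ℝ) × (Fin d → ℝ)) :
    pairwiseGaussian σ z w = pairwiseGaussian σ w z := by
  rw [pairwiseGaussian, pairwiseGaussian, sqDist_comm z w, sqDist_swap_left z w,
    sqDist_comm z w.swap]

/-- The skew-symmetric exponentials whose Gram matrix is the pairwise Gaussian kernel. -/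
def skewExp (σ : ℝ) (z : (Fin d → ℝ) × (Fin d → ℝ)) (x : EuclideanSpace ℝ (Fin d ⊕ Fin d)) : ℂ :=
  Complex.exp (inner ℝ x (feat σ z) * Complex.I)
    - Complex.exp (inner ℝ x (feat σ z.swap) * Complex.I)

open ProbabilityTheory Complex ComplexConjugate in
lemma integrable_exp_mul (σ : ℝ) (z w : (Fin d → ℝ) × (Fin d → ℝ)) :
    Integrable (fun x => cexp (inner ℝ x (feat σ z) * I) * conj (cexp (inner ℝ x (feat σ w) * I)))
      (stdGaussian (EuclideanSpace ℝ (Fin d ⊕ Fin d))) := by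
  refine Integrable.of_bound (C := 1) (Continuous.aestronglyMeasurable (by fun_prop))
    (.of_forall fun x => ?_)
  rw [norm_mul, RCLike.norm_conj, Complex.norm_exp_ofReal_mul_I, Complex.norm_exp_ofReal_mul_I,
    one_mul]

open ProbabilityTheory Complex ComplexConjugate in
lemma integrable_skewExp_mul (σ : ℝ) (z w : (Fin d → ℝ) × (Fin d → ℝ)) :
    Integrable (fun x => skewExp σ z x * conj (skewExp σ w x))
      (stdGaussian (EuclideanSpace ℝ (Fin d ⊕ Fin d))) := by
  simp only [skewExp, map_sub, mul_sub, sub_mul]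
  exact ((integrable_exp_mul σ z w).sub (integrable_exp_mul σ z.swap w)).sub
    ((integrable_exp_mul σ z w.swap).sub (integrable_exp_mul σ z.swap w.swap))

open ProbabilityTheory Complex ComplexConjugate in
lemma pairwiseGaussian_eq_integral (σ : ℝ) (z w : (Fin d → ℝ) × (Fin d → ℝ)) :
    ((4 * pairwiseGaussian σ z w : ℝ) : ℂ) =
      ∫ x, skewExp σ z x * conj (skewExp σ w x)
        ∂(stdGaussian (EuclideanSpace ℝ (Fin d ⊕ Fin d))) := by
  have h₁ := (integrable_exp_mul σ z w).sub (integrable_exp_mul σ z.swap w)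
  have h₂ := (integrable_exp_mul σ z w.swap).sub (integrable_exp_mul σ z.swap w.swap)
  have h := integral_sub h₁ h₂
  simp only [Pi.sub_apply] at h
  simp only [skewExp, map_sub, mul_sub, sub_mul]
  rw [h, integral_sub (integrable_exp_mul σ z w) (integrable_exp_mul σ z.swap w),
    integral_sub (integrable_exp_mul σ z w.swap) (integrable_exp_mul σ z.swap w.swap),
    ← exp_sqDist_eq, ← exp_sqDist_eq, ← exp_sqDist_eq, ← exp_sqDist_eq, sqDist_swap_swap,
    ← sqDist_swap_left, pairwiseGaussian]
  push_cast
  ring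

open ProbabilityTheory Complex ComplexConjugate in
lemma pairwiseGaussian_sum_nonneg {ι : Type*} (s : Finset ι) (c : ι → ℝ)
    (z : ι → (Fin d → ℝ) × (Fin d → ℝ)) (σ : ℝ) :
    0 ≤ ∑ i ∈ s, ∑ j ∈ s, c i * c j * pairwiseGaussian σ (z i) (z j) := by
  have key : ((4 * ∑ i ∈ s, ∑ j ∈ s, c i * c j * pairwiseGaussian σ (z i) (z j) : ℝ) : ℂ) =
      ((∫ x, ‖∑ i ∈ s, (c i : ℂ) * skewExp σ (z i) x‖ ^ 2
        ∂(stdGaussian (EuclideanSpace ℝ (Fin d ⊕ Fin d))) : ℝ) : ℂ) := by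
    rw [← integral_complex_ofReal]
    have h : ∀ x, ((‖∑ i ∈ s, (c i : ℂ) * skewExp σ (z i) x‖ ^ 2 : ℝ) : ℂ) =
        ∑ i ∈ s, ∑ j ∈ s, ((c i : ℂ) * c j) *
          (skewExp σ (z i) x * conj (skewExp σ (z j) x)) := fun x => by
      push_cast
      rw [← Complex.mul_conj', map_sum, Finset.sum_mul_sum]
      refine Finset.sum_congr rfl fun i _ => Finset.sum_congr rfl fun j _ => ?_
      rw [map_mul, conj_ofReal]
      ring
    simp only [h]
    rw [integral_finsetSum _ fun i _ => integrable_finsetSum _ fun j _ =>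
      (integrable_skewExp_mul σ (z i) (z j)).const_mul _]
    rw [Finset.mul_sum, ofReal_sum]
    refine Finset.sum_congr rfl fun i _ => ?_
    rw [integral_finsetSum _ fun j _ => (integrable_skewExp_mul σ (z i) (z j)).const_mul _,
      Finset.mul_sum, ofReal_sum]
    refine Finset.sum_congr rfl fun j _ => ?_
    rw [integral_const_mul, ← pairwiseGaussian_eq_integral]
    push_cast
    ring
  have := Complex.ofReal_injective key
  have h0 : 0 ≤ ∫ x, ‖∑ i ∈ s, (c i : ℂ) * skewExp σ (z i) x‖ ^ 2
        ∂(stdGaussian (EuclideanSpace ℝ (Fin d ⊕ Fin d))) :=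
    integral_nonneg fun x => by positivity
  linarith

/-- The restriction of the pairwise Gaussian kernel to `X² = X × X`, in the form in which Mathlib
takes real kernels: the entry `K z w : ℝ` acts on `ℝ` by multiplication. -/
def pairwiseGaussianMatrix (X : Set (Fin d → ℝ)) (σ : ℝ) : Matrix (X × X) (X × X) (ℝ →L[ℝ] ℝ) :=
  .of fun z w => pairwiseGaussian σ (z.map Subtype.val Subtype.val) (w.map Subtype.val Subtype.val) •
    (1 : ℝ →L[ℝ] ℝ)

theorem posSemidef_pairwiseGaussianMatrix (X : Set (Fin d → ℝ)) (σ : ℝ) :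
    (pairwiseGaussianMatrix X σ).PosSemidef := by
  have h := (RKHS.posSemidef_tfae (K := pairwiseGaussianMatrix X σ)).out 0 2
  refine h.mpr ⟨?_, fun v => ?_⟩
  · ext z w
    simp [pairwiseGaussianMatrix, Matrix.conjTranspose_apply, pairwiseGaussian_comm σ (w.map _ _)]
  · have := pairwiseGaussian_sum_nonneg v.support v
      (fun z => z.map Subtype.val Subtype.val) σ
    simp only [Finsupp.sum, pairwiseGaussianMatrix, RCLike.re_to_real]
    refine this.trans_eq ?_
    refine Finset.sum_congr rfl fun i _ => Finset.sum_congr rfl fun j _ => ?_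
    simp [pairwiseGaussian_comm σ (Prod.map _ _ i)]
    ring

instance (X : Set (Fin d → ℝ)) (σ : ℝ) : Fact (pairwiseGaussianMatrix X σ).PosSemidef :=
  ⟨posSemidef_pairwiseGaussianMatrix X σ⟩

/-- The reproducing kernel Hilbert space of the pairwise Gaussian kernel on `X²`. -/
def PairwiseGaussianRKHS (X : Set (Fin d → ℝ)) (σ : ℝ) : Type :=
  RKHS.OfKernel (pairwiseGaussianMatrix X σ)

instance (X : Set (Fin d → ℝ)) (σ : ℝ) : NormedAddCommGroup (PairwiseGaussianRKHS X σ) :=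
  inferInstanceAs (NormedAddCommGroup (RKHS.OfKernel (pairwiseGaussianMatrix X σ)))

instance (X : Set (Fin d → ℝ)) (σ : ℝ) : InnerProductSpace ℝ (PairwiseGaussianRKHS X σ) :=
  inferInstanceAs (InnerProductSpace ℝ (RKHS.OfKernel (pairwiseGaussianMatrix X σ)))

instance (X : Set (Fin d → ℝ)) (σ : ℝ) : CompleteSpace (PairwiseGaussianRKHS X σ) :=
  inferInstanceAs (CompleteSpace (RKHS.OfKernel (pairwiseGaussianMatrix X σ)))

instance (X : Set (Fin d → ℝ)) (σ : ℝ) : RKHS ℝ (PairwiseGaussianRKHS X σ) (X × X) ℝ :=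
  inferInstanceAs (RKHS ℝ (RKHS.OfKernel (pairwiseGaussianMatrix X σ)) (X × X) ℝ)

/-- The reproducing kernel of `PairwiseGaussianRKHS X σ` is the pairwise Gaussian kernel. -/
theorem kernel_pairwiseGaussianRKHS (X : Set (Fin d → ℝ)) (σ : ℝ) :
    RKHS.kernel (PairwiseGaussianRKHS X σ) = pairwiseGaussianMatrix X σ :=
  RKHS.OfKernel.kernel_ofKernel

end Kernel

/-! ### The box-counting condition and the constants -/

/-- `X ⊆ ℝᵈ` satisfies the upper box-counting dimension condition with constants `C` and `ϱ`: its
covering numbers for the sup-norm (the norm of `Fin d → ℝ`) satisfy `N(X, ε) ≤ C ε ^ (-ϱ)` for all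
`0 < ε ≤ 1`. -/
def BoxCountingCondition {d : ℕ} (X : Set (Fin d → ℝ)) (C ϱ : ℝ) : Prop :=
  1 ≤ C ∧ 0 < ϱ ∧ ∀ ε : ℝ≥0, 0 < ε → ε ≤ 1 →
    (Metric.coveringNumber ε X : ℝ≥0∞) ≤ ENNReal.ofReal (C * (ε : ℝ) ^ (-ϱ))

/-- The constant
`12 C² binom(4e + 2d, 2d) (2d + 1) ^ (2d + 1) / (2 ^ (2d + 1) e ^ (4d + 1))`,
with the generalized binomial coefficient `binom(t, k) = t (t - 1) ⋯ (t - k + 1) / k!`. -/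
def cStar (d : ℕ) (C : ℝ) : ℝ :=
  12 * C ^ 2 * Ring.choose (4 * Real.exp 1 + 2 * d) (2 * d) *
    ((2 * d + 1) ^ (2 * d + 1) / (2 ^ (2 * d + 1) * Real.exp (4 * d + 1)))

/-- The constant `(C* p ^ (-2d - 1) σ ^ (-2ϱ)) ^ (1 / (2p))`. -/
def capacityConst (d : ℕ) (C ϱ σ p : ℝ) : ℝ :=
  (cStar d C * p ^ (-(2 * (d : ℝ) + 1)) * σ ^ (-(2 * ϱ))) ^ (1 / (2 * p))

end

end PairwiseRanking

namespace PairwiseRanking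

/-! Only two facts about the measures matter: they are probability measures on `X × X`, and `|f z| ≤
‖f‖ / √2`, because the kernel is at most `1/2` on the diagonal. So the bound is proved for every
probability measure `μ`.

Write the target radius as `ε = exp (-L)`. Suppose a subspace `V` is such that unit-ball functions
orthogonal to it have `L₂(μ)`-norm at most `ε / 2`. Then a net in the unit ball of `V` is an `ε`-net
for the whole ball, with at most `(4 / ε) ^ dim V` points, hence about `dim V * (2 + 1.5 * L)` bits
(`entropyNumberId_le_of_orthogonal`). Two choices of `V` are used.

Coarse scales: the trace of the embedding is at most `1/2`, so by Bessel fewer than `2 * exp (2 *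
L)` directions are needed, whatever `σ` is (`exists_submodule_eLpNorm_orthogonal_le`).

Fine scales: cover `X` by at most `C * σ ^ (-ϱ)` sup-norm balls of radius `σ`, and expand the
Gaussian at each pair of centres. Killing all Taylor coefficients of degree at most `N` leaves a
Poisson tail, exponentially small in `N` (`exists_submodule_abs_le`). With `N` of order `L + d` the
dimension is at most `(number of pairs) * binom(N + 2d, 2d)`.

With `D = 2d`, the choice of `a` means `i = A * exp (2 * p * L)` with `A = a ^ (2p)`. The scales are
split at `L = D + 1/2`, and bounding this expression from below uniformly in `p` reduces each case
to a numerical inequality in `D` and `L`. -/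

lemma exists_and_not_succ {p : ℕ → Prop} (h0 : p 0) {B : ℝ} (hB : ∀ k, p k → (k : ℝ) ≤ B) :
    ∃ k, p k ∧ ¬ p (k + 1) := by
  by_contra! h
  obtain ⟨n, hn⟩ := exists_nat_gt B
  have hp : ∀ k, p k := fun k => by
    induction k with
    | zero => exact h0
    | succ k ih => exact h k ih
  exact absurd (hB n (hp n)) (not_le.mpr hn)

/-! ### Nets in finite-dimensional unit balls -/

/-- Volume bound for separated subsets of the unit ball of a finite-dimensional space. -/
theorem card_le_of_separated_closedBall {E : Type*} [NormedAddCommGroup E] [NormedSpace ℝ E]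
    [FiniteDimensional ℝ E] {δ : ℝ} (hδ : 0 < δ) (s : Finset E) (hs : ∀ c ∈ s, ‖c‖ ≤ 1)
    (h : ∀ c ∈ s, ∀ d ∈ s, c ≠ d → δ < ‖c - d‖) :
    (s.card : ℝ) ≤ (1 + 2 / δ) ^ Module.finrank ℝ E := by
  borelize E
  let μ : Measure E := Measure.addHaar
  have hr : 0 < δ / 2 := half_pos hδ
  have hR : 0 < 1 + δ / 2 := by positivity
  have hd : Set.Pairwise (s : Set E) (Function.onFun Disjoint fun c => Metric.ball c (δ / 2)) := by
    rintro c hc d hd hcd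
    apply Metric.ball_disjoint_ball
    rw [dist_eq_norm]
    linarith [h c hc d hd hcd]
  have hsub : (⋃ c ∈ s, Metric.ball (c : E) (δ / 2)) ⊆ Metric.ball (0 : E) (1 + δ / 2) := by
    refine iUnion₂_subset fun x hx => Metric.ball_subset_ball' ?_
    rw [dist_zero_right]
    linarith [hs x hx]
  have I : (s.card : ℝ≥0∞) * ENNReal.ofReal ((δ / 2) ^ Module.finrank ℝ E) * μ (Metric.ball 0 1) ≤
      ENNReal.ofReal ((1 + δ / 2) ^ Module.finrank ℝ E) * μ (Metric.ball 0 1) :=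
    calc
      _ = μ (⋃ c ∈ s, Metric.ball (c : E) (δ / 2)) := by
        rw [measure_biUnion_finset hd fun c _ => measurableSet_ball]
        simp only [μ.addHaar_ball_of_pos _ hr]
        simp only [Finset.sum_const, nsmul_eq_mul, mul_assoc]
      _ ≤ μ (Metric.ball (0 : E) (1 + δ / 2)) := measure_mono hsub
      _ = _ := by simp only [μ.addHaar_ball_of_pos _ hR]
  have J := (ENNReal.mul_le_mul_iff_left
    (Metric.measure_ball_pos _ _ zero_lt_one).ne' measure_ball_lt_top.ne).1 I
  have K := ENNReal.toReal_le_of_le_ofReal (pow_nonneg hR.le _) J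
  rw [ENNReal.toReal_mul, ENNReal.toReal_natCast, ENNReal.toReal_ofReal (by positivity),
    ← le_div_iff₀ (by positivity), ← div_pow, add_div, div_self hr.ne', one_div_div,
    add_comm] at K
  exact K

/-- The unit ball of a finite-dimensional space has a `δ`-net with at most `(1 + 2 / δ) ^ dim`
points. -/
theorem exists_net_closedBall (E : Type*) [NormedAddCommGroup E] [NormedSpace ℝ E]
    [FiniteDimensional ℝ E] {δ : ℝ} (hδ : 0 < δ) :
    ∃ s : Finset E, (∀ c ∈ s, ‖c‖ ≤ 1) ∧ (∀ x : E, ‖x‖ ≤ 1 → ∃ c ∈ s, ‖x - c‖ ≤ δ) ∧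
      (s.card : ℝ) ≤ (1 + 2 / δ) ^ Module.finrank ℝ E := by
  classical
  obtain ⟨k, ⟨s, rfl, hs, h⟩, hk⟩ := exists_and_not_succ
    (p := fun k => ∃ s : Finset E, s.card = k ∧ (∀ c ∈ s, ‖c‖ ≤ 1) ∧
      ∀ c ∈ s, ∀ d ∈ s, c ≠ d → δ < ‖c - d‖)
    ⟨∅, by simp⟩ (B := (1 + 2 / δ) ^ Module.finrank ℝ E)
    (by rintro _ ⟨s, rfl, hs, h⟩; exact card_le_of_separated_closedBall hδ s hs h)
  refine ⟨s, hs, fun x hx => ?_, card_le_of_separated_closedBall hδ s hs h⟩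
  by_contra! hc
  have hxs : x ∉ s := fun hxs => by simpa using (hc x hxs).trans' hδ
  refine hk ⟨insert x s, Finset.card_insert_of_notMem hxs, ?_, ?_⟩
  · simpa [hx] using hs
  · intro c hc' d hd' hcd
    rcases Finset.mem_insert.mp hc' with hc₁ | hc₁ <;>
      rcases Finset.mem_insert.mp hd' with hd₁ | hd₁
    · exact absurd (hc₁.trans hd₁.symm) hcd
    · exact hc₁ ▸ hc d hd₁
    · rw [norm_sub_rev]; exact hd₁ ▸ hc c hc₁
    · exact h c hc₁ d hd₁ hcd

/-! ### Entropy numbers from finite-dimensional subspaces -/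

section Entropy

variable {Ω : Type*} {H : Type*} [NormedAddCommGroup H] [InnerProductSpace ℝ H] [RKHS ℝ H Ω ℝ]
  [MeasurableSpace Ω]

theorem entropyNumberId_le_of_finset {μ : Measure Ω} {ε : ℝ} (hε : 0 < ε) {i : ℕ} (s : Finset H)
    (hs : ∀ c ∈ s, ‖c‖ ≤ 1) (hcard : s.card ≤ 2 ^ (i - 1))
    (h : ∀ f : H, ‖f‖ ≤ 1 → ∃ c ∈ s, eLpNorm (f - c : H) 2 μ ≤ ENNReal.ofReal ε) :
    entropyNumberId H μ i ≤ ENNReal.ofReal ε := by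
  obtain ⟨c₀, hc₀, -⟩ := h 0 (by simp)
  have hcard' : Fintype.card s ≤ Fintype.card (Fin (2 ^ (i - 1))) := by simpa using hcard
  obtain ⟨e⟩ := Function.Embedding.nonempty_of_card_le hcard'
  have : Nonempty s := ⟨⟨c₀, hc₀⟩⟩
  -- `entropyNumber` asks for exactly `2 ^ (i - 1)` centres, so a smaller net is enumerated with
  -- repetitions.
  let g : Fin (2 ^ (i - 1)) → s := Function.invFun e
  have hg : Function.Surjective g := Function.invFun_surjective e.injective
  rw [entropyNumberId, entropyNumber]
  refine iInf₂_le (ε.toNNReal) ⟨Real.toNNReal_pos.mpr hε, fun j => ((g j : H) : Ω → ℝ),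
    fun j => ⟨g j, by simpa using hs _ (g j).2, rfl⟩, ?_⟩
  rintro _ ⟨f, hf, rfl⟩
  obtain ⟨c, hc, hfc⟩ := h f (by simpa using hf)
  obtain ⟨j, hj⟩ := hg ⟨c, hc⟩
  refine ⟨j, ?_⟩
  simp only [hj]
  simpa [ENNReal.ofReal] using hfc

/-- If the evaluations are bounded by `1 / √2` and the functions orthogonal to `V` are small in
`L₂(μ)`, then the entropy numbers are controlled by a net in the unit ball of `V`. -/
theorem entropyNumberId_le_of_orthogonal {μ : Measure Ω} [IsProbabilityMeasure μ]
    (hmeas : ∀ f : H, AEStronglyMeasurable (f : Ω → ℝ) μ)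
    (hbd : ∀ (f : H) (z : Ω), |f z| ≤ ‖f‖ / √2)
    (V : Submodule ℝ H) [FiniteDimensional ℝ V] {ε : ℝ} (hε : 0 < ε) (hε1 : ε ≤ 1)
    (hV : ∀ f ∈ Vᗮ, ‖f‖ ≤ 1 → eLpNorm f 2 μ ≤ ENNReal.ofReal (ε / 2)) {i : ℕ}
    (hi : (4 / ε) ^ Module.finrank ℝ V ≤ 2 ^ (i - 1)) :
    entropyNumberId H μ i ≤ ENNReal.ofReal ε := by
  classical
  have h2 : (0 : ℝ) < √2 := by positivity
  obtain ⟨s, hs, hnet, hcard⟩ := exists_net_closedBall V (δ := ε / √2) (by positivity)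
  refine entropyNumberId_le_of_finset hε (s.image Subtype.val) ?_ ?_ ?_
  · intro c hc
    obtain ⟨c, hc', rfl⟩ := Finset.mem_image.mp hc
    exact hs c hc'
  -- After clearing `ε` this is `ε + 2 * √2 ≤ 1 + 3`. The mesh `ε / √2` in `H`-norm becomes `ε / 2`
  -- in sup-norm.
  · have hle : 1 + 2 / (ε / √2) ≤ 4 / ε := by
      rw [div_div_eq_mul_div, le_div_iff₀ hε, add_mul, div_mul_cancel₀ _ hε.ne']
      have : √2 ≤ 1.5 := by rw [Real.sqrt_le_left (by norm_num)]; norm_num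
      linarith
    have : (s.card : ℝ) ≤ 2 ^ (i - 1) :=
      (hcard.trans (pow_le_pow_left₀ (by positivity) hle _)).trans hi
    exact Finset.card_image_le.trans (by exact_mod_cast this)
  · intro f hf
    obtain ⟨c, hc, hfc⟩ := hnet (V.orthogonalProjectionOnto f)
      ((V.norm_orthogonalProjectionOnto_apply_le f).trans hf)
    refine ⟨c, Finset.mem_image_of_mem _ hc, ?_⟩
    have hdec : ((f - c : H) : Ω → ℝ) =
        ((f - V.orthogonalProjectionOnto f : H) : Ω → ℝ) +
          ((V.orthogonalProjectionOnto f - c : V) : H) := by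
      rw [← RKHS.coe_add]
      simp
    rw [hdec]
    refine (eLpNorm_add_le (hmeas _) (hmeas _) (by norm_num)).trans ?_
    have h₁ := hV _ (V.sub_starProjection_mem_orthogonal f) (by
      rw [← V.starProjection_orthogonal_val]
      exact (Vᗮ.norm_starProjection_apply_le f).trans hf)
    have h₂ : eLpNorm (((V.orthogonalProjectionOnto f - c : V) : H) : Ω → ℝ) 2 μ
        ≤ ENNReal.ofReal (ε / 2) := by
      refine (eLpNorm_le_of_ae_bound (C := ε / 2) (.of_forall fun z => ?_)).trans ?_
      · refine (hbd _ z).trans ?_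
        rw [div_le_iff₀ h2]
        refine hfc.trans ?_
        rw [div_le_iff₀ h2, mul_assoc, Real.mul_self_sqrt (by norm_num)]
        linarith
      · simp
    refine (add_le_add h₁ h₂).trans ?_
    rw [← ENNReal.ofReal_add (by positivity) (by positivity), add_halves]

/-- There is a subspace of dimension at most `1 / (2 η ^ 2)` such that the unit vectors orthogonal
to it have `L₂(μ)`-norm at most `η`. -/
theorem exists_submodule_eLpNorm_orthogonal_le [CompleteSpace H] {μ : Measure Ω}
    [IsProbabilityMeasure μ]
    (hmeas : ∀ f : H, AEStronglyMeasurable (f : Ω → ℝ) μ)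
    (hbd : ∀ (f : H) (z : Ω), |f z| ≤ ‖f‖ / √2) {η : ℝ} (hη : 0 < η) :
    ∃ V : Submodule ℝ H, FiniteDimensional ℝ V ∧ (Module.finrank ℝ V : ℝ) ≤ 1 / (2 * η ^ 2) ∧
      ∀ f ∈ Vᗮ, ‖f‖ ≤ 1 → eLpNorm f 2 μ ≤ ENNReal.ofReal η := by
  have hLp : ∀ f : H, MemLp (f : Ω → ℝ) 2 μ := fun f =>
    MemLp.of_bound (hmeas f) (‖f‖ / √2) (.of_forall fun z => hbd f z)
  -- The evaluation bound applied to the kernel section at its own point gives `‖k_z‖² = k_z(z) ≤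
  -- ‖k_z‖ / √2`.
  have hker : ∀ z, ‖RKHS.kerFun H z (1 : ℝ)‖ ^ 2 ≤ 1 / 2 := fun z => by
    have h := hbd (RKHS.kerFun H z (1 : ℝ)) z
    have h' : ‖RKHS.kerFun H z (1 : ℝ)‖ ^ 2 = RKHS.kerFun H z (1 : ℝ) z := by
      rw [← real_inner_self_eq_norm_sq, RKHS.inner_kerFun]
      simp
    have h2 : (0 : ℝ) < √2 := by positivity
    rw [← h', abs_of_nonneg (by positivity), le_div_iff₀ h2] at h
    rcases eq_or_lt_of_le (norm_nonneg (RKHS.kerFun H z (1 : ℝ))) with h0 | h0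
    · rw [← h0]; norm_num
    · have : ‖RKHS.kerFun H z (1 : ℝ)‖ * √2 ≤ 1 := by nlinarith
      have := pow_le_pow_left₀ (by positivity) this 2
      rw [mul_pow, Real.sq_sqrt (by norm_num)] at this
      linarith
  have hbound : ∀ k, (∃ v : Fin k → H, Orthonormal ℝ v ∧ ∀ j, η ^ 2 < ∫ z, v j z ^ 2 ∂μ) →
      (k : ℝ) ≤ 1 / (2 * η ^ 2) := by
    rintro k ⟨v, hv, hvη⟩
    have h₁ : (k : ℝ) * η ^ 2 ≤ ∑ j, ∫ z, v j z ^ 2 ∂μ := by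
      simpa using Finset.sum_le_sum fun j (_ : j ∈ Finset.univ) => (hvη j).le
    rw [← integral_finsetSum _ fun j _ => (hLp (v j)).integrable_sq] at h₁
    have h₂ : ∫ z, ∑ j, v j z ^ 2 ∂μ ≤ ∫ _, (1 / 2 : ℝ) ∂μ := by
      refine integral_mono (integrable_finsetSum _ fun j _ => (hLp (v j)).integrable_sq)
        (integrable_const _) fun z => ?_
      -- Bessel's inequality for `k_z`: the coefficients are the values `v j z`, so `∑ j, v j z ^ 2
      -- ≤ 1/2` pointwise.
      have := hv.sum_inner_products_le (RKHS.kerFun H z (1 : ℝ)) (s := Finset.univ)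
      refine le_trans (le_of_eq ?_) (this.trans (hker z))
      simp
    rw [le_div_iff₀ (by positivity)]
    simp at h₂
    linarith
  -- A maximal orthonormal system of functions with `L₂`-norm above `η`. An offending `f` orthogonal
  -- to it could be normalised and adjoined; since `‖f‖ ≤ 1`, normalising does not shrink its
  -- `L₂`-norm.
  obtain ⟨k, ⟨v, hv, hvη⟩, hk⟩ := exists_and_not_succ ⟨![], by simp, by simp⟩ hbound
  refine ⟨Submodule.span ℝ (range v), FiniteDimensional.span_of_finite ℝ (finite_range v), ?_, fun f hf hf1 => ?_⟩
  · rw [finrank_span_eq_card hv.linearIndependent, Fintype.card_fin]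
    exact hbound k ⟨v, hv, hvη⟩
  · by_contra! hlt
    rw [(hLp f).eLpNorm_eq_integral_rpow_norm (by norm_num) (by norm_num),
      ENNReal.ofReal_lt_ofReal_iff'] at hlt
    have hlt : η ^ 2 < ∫ z, f z ^ 2 ∂μ := by
      have := hlt.1
      simp only [ENNReal.toReal_ofNat, Real.rpow_ofNat, Real.norm_eq_abs, sq_abs] at this
      rw [← one_div, ← Real.sqrt_eq_rpow, Real.lt_sqrt hη.le] at this
      exact this
    have hf0 : f ≠ 0 := by
      rintro rfl
      simp at hlt
      nlinarith
    have hnf : 0 < ‖f‖ := norm_pos_iff.mpr hf0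
    refine hk ⟨Matrix.vecCons (‖f‖⁻¹ • f) v, ?_, ?_⟩
    · rw [orthonormal_vecCons_iff]
      refine ⟨by rw [norm_smul, norm_inv, norm_norm, inv_mul_cancel₀ hnf.ne'], fun j => ?_, hv⟩
      rw [inner_smul_left, Submodule.inner_left_of_mem_orthogonal
        (Submodule.subset_span (mem_range_self j)) hf, mul_zero]
    · intro j
      refine Fin.cases ?_ (fun j => ?_) j
      · simp only [Matrix.cons_val_zero, RKHS.coe_smul, Pi.smul_apply, smul_eq_mul, mul_pow,
          integral_const_mul]
        refine hlt.trans_le (le_mul_of_one_le_left (by positivity) ?_)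
        exact one_le_pow₀ ((one_le_inv₀ hnf).mpr hf1)
      · simpa using hvη j

end Entropy

/-! ### Feature maps and the Taylor expansion of the Gaussian kernel -/

section Feature

/-- A map into a Hilbert space whose Gram matrix is the kernel extends to a contraction of the
reproducing kernel Hilbert space, and evaluations are inner products in the feature space. -/
theorem exists_feature_contraction {Ω H E : Type*} [NormedAddCommGroup H] [InnerProductSpace ℝ H]
    [CompleteSpace H] [RKHS ℝ H Ω ℝ] [NormedAddCommGroup E] [InnerProductSpace ℝ E]
    [CompleteSpace E] (Ψ : Ω → E)
    (hΨ : ∀ z w, inner ℝ (Ψ z) (Ψ w) = RKHS.kernel H z w (1 : ℝ)) :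
    ∃ J : H →L[ℝ] E, (∀ f, ‖J f‖ ≤ ‖f‖) ∧
      ∀ (z : Ω) (e : E), (∀ w, inner ℝ e (Ψ w) = RKHS.kernel H z w (1 : ℝ)) →
        ∀ f : H, f z = inner ℝ e (J f) := by
  let k : Ω → H := fun z => RKHS.kerFun H z (1 : ℝ)
  have hk : ∀ z w, inner ℝ (k z) (k w) = RKHS.kernel H z w (1 : ℝ) := fun z w => by
    simp only [k, RKHS.kerFun_inner, RKHS.kerFun_apply]
    simp
  let e : (Ω →₀ ℝ) →ₗ[ℝ] H := Finsupp.linearCombination ℝ k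
  let g : (Ω →₀ ℝ) →ₗ[ℝ] E := Finsupp.linearCombination ℝ Ψ
  have hdense : DenseRange e := by
    have h := RKHS.kerFun_dense (H := H)
    rw [DenseRange, ← LinearMap.coe_range, Finsupp.range_linearCombination,
      Submodule.dense_iff_topologicalClosure_eq_top, eq_top_iff, ← h]
    refine Submodule.topologicalClosure_mono (Submodule.span_le.mpr ?_)
    rintro _ ⟨z, v, rfl⟩
    have : RKHS.kerFun H z v = v • k z := by
      rw [← map_smul, smul_eq_mul, mul_one]
    rw [this]
    exact Submodule.smul_mem _ _ (Submodule.subset_span (mem_range_self z))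
  -- Equal Gram matrices make `k w ↦ Ψ w` isometric on finite combinations, hence well defined and
  -- extendable.
  have hnorm : ∀ a, ‖g a‖ ≤ 1 * ‖e a‖ := fun a => by
    rw [one_mul]
    refine le_of_eq ?_
    rw [← sq_eq_sq₀ (norm_nonneg _) (norm_nonneg _), ← real_inner_self_eq_norm_sq,
      ← real_inner_self_eq_norm_sq]
    simp only [g, e, Finsupp.linearCombination_apply, Finsupp.sum_inner, Finsupp.inner_sum,
      inner_smul_left, inner_smul_right, hk, hΨ]
  let J := g.extendOfNorm e
  have hJ : ∀ w, J (k w) = Ψ w := fun w => by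
    have := LinearMap.extendOfNorm_eq hdense ⟨1, hnorm⟩ (Finsupp.single w 1)
    simpa [e, g] using this
  refine ⟨J, fun f => by simpa using LinearMap.norm_extendOfNorm_apply_le hdense 1 hnorm f,
    fun z b hb f => ?_⟩
  have hb' : J.adjoint b = k z := by
    ext w
    have h₁ : (J.adjoint b) w = inner ℝ (J.adjoint b) (k w) := by simp [k]
    have h₂ : (k z) w = inner ℝ (k z) (k w) := by simp [k]
    rw [h₁, h₂, ContinuousLinearMap.adjoint_inner_left, hJ, hb, hk]
  rw [← ContinuousLinearMap.adjoint_inner_left, hb']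
  simp [k]

variable {ι : Type*} [Fintype ι] [DecidableEq ι]

lemma card_piAntidiag_univ (k : ℕ) :
    (Finset.piAntidiag (Finset.univ : Finset ι) k).card = (Fintype.card ι).multichoose k := by
  rw [← Finset.map_sym_eq_piAntidiag, Finset.card_map, Finset.sym_univ, Finset.card_univ,
    Sym.card_sym_eq_multichoose]

/-- The homogeneous component of degree `k` of the Taylor feature map of the Gaussian kernel. -/
noncomputable def gaussCoord (u : EuclideanSpace ℝ ι) (k : ℕ) :
    EuclideanSpace ℝ (Finset.piAntidiag (Finset.univ : Finset ι) k) :=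
  WithLp.toLp 2 fun α => Real.exp (-(‖u‖ ^ 2 / 2)) *
    √(Nat.multinomial Finset.univ α.1 / k.factorial) * ∏ j, u j ^ α.1 j

/-- The multinomial theorem for `(∑ j, u j * v j) ^ k`. Summed over `k`, it rebuilds `exp ⟪u, v⟫`,
and the Gaussian prefactors complete the square. -/
lemma inner_gaussCoord (u v : EuclideanSpace ℝ ι) (k : ℕ) :
    inner ℝ (gaussCoord u k) (gaussCoord v k) =
      Real.exp (-(‖u‖ ^ 2 / 2)) * Real.exp (-(‖v‖ ^ 2 / 2)) *
        (inner ℝ u v ^ k / k.factorial) := by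
  have h : inner ℝ u v = ∑ j, u j * v j := by
    rw [PiLp.inner_apply]
    exact Finset.sum_congr rfl fun j _ => by simp [mul_comm]
  rw [h, Finset.sum_pow_eq_sum_piAntidiag, PiLp.inner_apply, Finset.sum_div, Finset.mul_sum,
    ← Finset.sum_coe_sort (Finset.piAntidiag (Finset.univ : Finset ι) k)]
  refine Finset.sum_congr rfl fun α _ => ?_
  have hs : √((Nat.multinomial Finset.univ α.1 : ℝ) / k.factorial) *
      √((Nat.multinomial Finset.univ α.1 : ℝ) / k.factorial) =
      (Nat.multinomial Finset.univ α.1 : ℝ) / k.factorial :=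
    Real.mul_self_sqrt (by positivity)
  simp only [gaussCoord, mul_pow, Finset.prod_mul_distrib, RCLike.inner_apply, conj_trivial]
  linear_combination (Real.exp (-(‖u‖ ^ 2 / 2)) * Real.exp (-(‖v‖ ^ 2 / 2)) *
    (∏ j, u j ^ α.1 j) * ∏ j, v j ^ α.1 j) * hs

lemma norm_gaussCoord_sq (u : EuclideanSpace ℝ ι) (k : ℕ) :
    ‖gaussCoord u k‖ ^ 2 = Real.exp (-‖u‖ ^ 2) * ((‖u‖ ^ 2) ^ k / k.factorial) := by
  rw [← real_inner_self_eq_norm_sq, inner_gaussCoord, real_inner_self_eq_norm_sq, ← Real.exp_add]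
  ring_nf

lemma memℓp_gaussCoord (u : EuclideanSpace ℝ ι) : Memℓp (gaussCoord u) 2 := by
  refine memℓp_gen ?_
  simp only [ENNReal.toReal_ofNat, Real.rpow_ofNat, norm_gaussCoord_sq]
  exact (Real.summable_pow_div_factorial _).mul_left _

/-- The feature map of the Gaussian kernel given by the Taylor series at the origin. -/
noncomputable def gaussFeature (u : EuclideanSpace ℝ ι) :
    lp (fun k : ℕ => EuclideanSpace ℝ (Finset.piAntidiag (Finset.univ : Finset ι) k)) 2 :=
  ⟨gaussCoord u, memℓp_gaussCoord u⟩

lemma hasSum_exp_div_factorial (x : ℝ) :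
    HasSum (fun k : ℕ => x ^ k / k.factorial) (Real.exp x) := by
  rw [Real.exp_eq_exp_ℝ]
  exact NormedSpace.expSeries_div_hasSum_exp x

lemma inner_gaussFeature (u v : EuclideanSpace ℝ ι) :
    inner ℝ (gaussFeature u) (gaussFeature v) = Real.exp (-(‖u - v‖ ^ 2 / 2)) := by
  have h := lp.hasSum_inner (𝕜 := ℝ) (gaussFeature u) (gaussFeature v)
  refine h.unique ?_
  have h' := (hasSum_exp_div_factorial (inner ℝ u v)).mul_left
    (Real.exp (-(‖u‖ ^ 2 / 2)) * Real.exp (-(‖v‖ ^ 2 / 2)))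
  have heq : Real.exp (-(‖u - v‖ ^ 2 / 2)) =
      Real.exp (-(‖u‖ ^ 2 / 2)) * Real.exp (-(‖v‖ ^ 2 / 2)) * Real.exp (inner ℝ u v) := by
    rw [← Real.exp_add, ← Real.exp_add, norm_sub_sq_real]
    ring_nf
  rw [heq]
  have hcongr : (fun k => inner ℝ (gaussFeature u k) (gaussFeature v k)) = fun k : ℕ =>
      Real.exp (-(‖u‖ ^ 2 / 2)) * Real.exp (-(‖v‖ ^ 2 / 2)) *
        (inner ℝ u v ^ k / k.factorial) := funext fun k => inner_gaussCoord u v k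
  rw [hcongr]
  exact h'

/-- Chernoff bound for the tail of the exponential series. -/
lemma hasSum_tail_le {x S : ℝ} (hx : 0 ≤ x) (N : ℕ)
    (h : HasSum (fun k : ℕ => if k ≤ N then 0 else Real.exp (-x) * (x ^ k / k.factorial)) S) :
    S ≤ Real.exp (x * (Real.exp 1 - 1) - (N + 1)) := by
  have h' := (hasSum_exp_div_factorial (Real.exp 1 * x)).mul_left (Real.exp (-x) * Real.exp (-(N + 1)))
  have heq : Real.exp (x * (Real.exp 1 - 1) - (N + 1)) =
      Real.exp (-x) * Real.exp (-(N + 1)) * Real.exp (Real.exp 1 * x) := by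
    rw [← Real.exp_add, ← Real.exp_add]
    ring_nf
  rw [heq]
  refine hasSum_le (fun k => ?_) h h'
  split_ifs with hk
  · positivity
  -- For `k ≥ N + 1` the weight `exp (k - (N + 1))` is at least one; it turns the tail into a full
  -- exponential series at `e * x`.
  · have h1 : (1 : ℝ) ≤ Real.exp (-(N + 1)) * Real.exp 1 ^ k := by
      rw [← Real.exp_nat_mul, ← Real.exp_add, Real.one_le_exp_iff]
      have : (N : ℝ) + 1 ≤ k := by exact_mod_cast not_le.mp hk
      linarith
    rw [mul_pow]
    have h2 : 0 ≤ Real.exp (-x) * (x ^ k / k.factorial) := by positivity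
    calc Real.exp (-x) * (x ^ k / k.factorial)
        ≤ Real.exp (-x) * (x ^ k / k.factorial) * (Real.exp (-(N + 1)) * Real.exp 1 ^ k) :=
          le_mul_of_one_le_right h2 h1
      _ = _ := by ring

/-- Vectors without components of degree at most `N` are almost orthogonal to the features. -/
lemma abs_inner_gaussFeature_le (u : EuclideanSpace ℝ ι) (N : ℕ)
    (g : lp (fun k : ℕ => EuclideanSpace ℝ (Finset.piAntidiag (Finset.univ : Finset ι) k)) 2)
    (hg : ∀ k ≤ N, g k = 0) :
    |inner ℝ (gaussFeature u) g| ≤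
      √(Real.exp (‖u‖ ^ 2 * (Real.exp 1 - 1) - (N + 1))) * ‖g‖ := by
  let t : ∀ k : ℕ, EuclideanSpace ℝ (Finset.piAntidiag (Finset.univ : Finset ι) k) :=
    fun k => if k ≤ N then 0 else gaussCoord u k
  have ht : ∀ k, ‖t k‖ ^ 2 =
      if k ≤ N then 0 else Real.exp (-‖u‖ ^ 2) * ((‖u‖ ^ 2) ^ k / k.factorial) := fun k => by
    simp only [t]
    split_ifs
    · simp
    · exact norm_gaussCoord_sq u k
  have hmem : Memℓp t 2 := by
    refine memℓp_gen ?_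
    simp only [ENNReal.toReal_ofNat, Real.rpow_ofNat, ht]
    refine Summable.of_nonneg_of_le (fun k => ?_) (fun k => ?_)
      ((Real.summable_pow_div_factorial (‖u‖ ^ 2)).mul_left (Real.exp (-‖u‖ ^ 2)))
    · split_ifs <;> positivity
    · split_ifs
      · positivity
      · exact le_rfl
  let T : lp (fun k : ℕ => EuclideanSpace ℝ (Finset.piAntidiag (Finset.univ : Finset ι) k)) 2 :=
    ⟨t, hmem⟩
  -- Only degrees above `N` meet `g`, so the feature may be replaced by its tail `T` before
  -- Cauchy–Schwarz.
  have hin : inner ℝ (gaussFeature u) g = inner ℝ T g := by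
    rw [lp.inner_eq_tsum, lp.inner_eq_tsum]
    refine tsum_congr fun k => ?_
    by_cases hk : k ≤ N
    · rw [hg k hk, inner_zero_right, inner_zero_right]
    · have : T k = gaussFeature u k := if_neg hk
      rw [this]
  rw [hin]
  refine (abs_real_inner_le_norm _ _).trans (mul_le_mul_of_nonneg_right ?_ (norm_nonneg _))
  refine Real.le_sqrt_of_sq_le ?_
  have hs := lp.hasSum_norm (p := 2) (by norm_num) T
  simp only [ENNReal.toReal_ofNat, Real.rpow_ofNat] at hs
  refine hasSum_tail_le (sq_nonneg _) N ?_
  have : (fun k => ‖T k‖ ^ 2) = fun k : ℕ =>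
      if k ≤ N then 0 else Real.exp (-‖u‖ ^ 2) * ((‖u‖ ^ 2) ^ k / k.factorial) := funext ht
  rwa [this] at hs

end Feature

/-! ### The pairwise Gaussian space: evaluation bounds and Taylor subspaces -/

section PairwiseGaussian

variable {d : ℕ} {X : Set (Fin d → ℝ)} {σ : ℝ}

/-- The point of `ℝᵈ × ℝᵈ` underlying a point of `X²`. -/
abbrev pairVal (z : X × X) : (Fin d → ℝ) × (Fin d → ℝ) := z.map Subtype.val Subtype.val

lemma kernel_pairwiseGaussianRKHS_apply (z w : X × X) :
    RKHS.kernel (PairwiseGaussianRKHS X σ) z w (1 : ℝ) =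
      pairwiseGaussian σ (pairVal z) (pairVal w) := by
  rw [kernel_pairwiseGaussianRKHS]
  simp [pairwiseGaussianMatrix]

lemma sqDist_self (z : (Fin d → ℝ) × (Fin d → ℝ)) : sqDist z z = 0 := by
  simp [sqDist]

lemma norm_kerFun_sq (z : X × X) :
    ‖RKHS.kerFun (PairwiseGaussianRKHS X σ) z (1 : ℝ)‖ ^ 2 =
      pairwiseGaussian σ (pairVal z) (pairVal z) := by
  rw [← real_inner_self_eq_norm_sq, RKHS.inner_kerFun, RKHS.kerFun_apply,
    kernel_pairwiseGaussianRKHS_apply]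
  simp

lemma apply_eq_inner_kerFun (f : PairwiseGaussianRKHS X σ) (z : X × X) :
    f z = inner ℝ (RKHS.kerFun (PairwiseGaussianRKHS X σ) z (1 : ℝ)) f := by
  simp

lemma abs_apply_le_norm_mul_sqrt (f : PairwiseGaussianRKHS X σ) (z : X × X) :
    |f z| ≤ ‖f‖ * √(pairwiseGaussian σ (pairVal z) (pairVal z)) := by
  rw [← norm_kerFun_sq, Real.sqrt_sq (norm_nonneg _), apply_eq_inner_kerFun, mul_comm]
  exact abs_real_inner_le_norm _ _

lemma abs_apply_le (f : PairwiseGaussianRKHS X σ) (z : X × X) : |f z| ≤ ‖f‖ / √2 := by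
  refine (abs_apply_le_norm_mul_sqrt f z).trans ?_
  rw [div_eq_mul_inv, ← Real.sqrt_inv]
  refine mul_le_mul_of_nonneg_left (Real.sqrt_le_sqrt ?_) (norm_nonneg f)
  rw [pairwiseGaussian, sqDist_self]
  have := Real.exp_nonneg (-(sqDist (pairVal z).swap (pairVal z) / σ ^ 2))
  simp only [zero_div, neg_zero, Real.exp_zero]
  linarith

/-- In dimension zero the pairwise Gaussian kernel vanishes. -/
lemma apply_eq_zero_of_dim_zero {X : Set (Fin 0 → ℝ)} (f : PairwiseGaussianRKHS X σ) (z : X × X) :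
    f z = 0 := by
  have h := abs_apply_le_norm_mul_sqrt f z
  have h0 : pairwiseGaussian σ (pairVal z) (pairVal z) = 0 := by
    simp [pairwiseGaussian, sqDist]
  rw [h0, Real.sqrt_zero, mul_zero] at h
  exact abs_nonpos_iff.mp h

/-- Supplies measurability. Since `‖k_w - k_z‖²` is an expression in kernel values, continuity of
the kernel makes `z ↦ k_z` continuous. -/
lemma continuous_coe (f : PairwiseGaussianRKHS X σ) : Continuous (f : X × X → ℝ) := by
  have hG : Continuous fun q : ((Fin d → ℝ) × (Fin d → ℝ)) × ((Fin d → ℝ) × (Fin d → ℝ)) =>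
      pairwiseGaussian σ q.1 q.2 := by
    unfold pairwiseGaussian sqDist
    simp only [Prod.fst_swap, Prod.snd_swap]
    fun_prop
  have hval : Continuous fun z : X × X => pairVal z :=
    continuous_subtype_val.prodMap continuous_subtype_val
  have hK : Continuous fun q : (X × X) × (X × X) =>
      pairwiseGaussian σ (pairVal q.1) (pairVal q.2) := by
    have h := hG.comp ((hval.comp continuous_fst).prodMk (hval.comp continuous_snd))
    exact h
  let k := fun z : X × X => RKHS.kerFun (PairwiseGaussianRKHS X σ) z (1 : ℝ)
  have hk : ∀ z w, inner ℝ (k z) (k w) = pairwiseGaussian σ (pairVal z) (pairVal w) :=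
    fun z w => by
      simp only [k, RKHS.kerFun_inner, RKHS.kerFun_apply, kernel_pairwiseGaussianRKHS_apply]
      simp
  have hcont : Continuous k := by
    refine continuous_iff_continuousAt.mpr fun z => ?_
    refine tendsto_iff_norm_sub_tendsto_zero.mpr ?_
    have heq : ∀ w, ‖k w - k z‖ = √(pairwiseGaussian σ (pairVal w) (pairVal w) -
        2 * pairwiseGaussian σ (pairVal w) (pairVal z) +
          pairwiseGaussian σ (pairVal z) (pairVal z)) := fun w => by
      rw [← hk, ← hk, ← hk, real_inner_self_eq_norm_sq, real_inner_self_eq_norm_sq,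
        ← norm_sub_sq_real, Real.sqrt_sq (norm_nonneg _)]
    have hc : Continuous fun w => ‖k w - k z‖ := by
      simp only [heq]
      have h₁ := hK.comp (Continuous.prodMk continuous_id continuous_id : Continuous
        fun w : X × X => (w, w))
      have h₂ := hK.comp (Continuous.prodMk continuous_id continuous_const : Continuous
        fun w : X × X => (w, z))
      simp only [Function.comp_def] at h₁ h₂
      exact ((h₁.sub (h₂.const_mul 2)).add continuous_const).sqrt
    simpa using hc.tendsto z
  have : (f : X × X → ℝ) = fun z => inner ℝ (k z) f := funext fun z => apply_eq_inner_kerFun f z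
  rw [this]
  exact hcont.inner continuous_const

lemma norm_feat_sub_sq_le (hσ : 0 < σ) (z c : (Fin d → ℝ) × (Fin d → ℝ))
    (h₁ : dist z.1 c.1 ≤ σ) (h₂ : dist z.2 c.2 ≤ σ) : ‖feat σ z - feat σ c‖ ^ 2 ≤ 4 * d := by
  have key : ∀ x y : Fin d → ℝ, dist x y ≤ σ → ∑ k, (x k - y k) ^ 2 ≤ d * σ ^ 2 := by
    intro x y hxy
    have : ∀ k ∈ Finset.univ, (x k - y k) ^ 2 ≤ σ ^ 2 := fun k _ => by
      rw [← sq_abs, ← Real.dist_eq]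
      exact pow_le_pow_left₀ dist_nonneg ((dist_le_pi_dist x y k).trans hxy) 2
    simpa using Finset.sum_le_sum this
  have h := norm_feat_sub σ z c
  have hs : sqDist z c / σ ^ 2 ≤ 2 * d := by
    rw [div_le_iff₀ (by positivity), sqDist]
    linarith [key _ _ h₁, key _ _ h₂]
  linarith

/-- Near a point `c` of `ℝ²ᵈ` all functions of the reproducing kernel Hilbert space are given by
their Taylor features at `c`. -/
theorem exists_taylor (X : Set (Fin d → ℝ)) (σ : ℝ)
    (c : (Fin d → ℝ) × (Fin d → ℝ)) :
    ∃ J : PairwiseGaussianRKHS X σ →L[ℝ] lp (fun k : ℕ => EuclideanSpace ℝ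
      (Finset.piAntidiag (Finset.univ : Finset (Fin d ⊕ Fin d)) k)) 2,
      (∀ f, ‖J f‖ ≤ ‖f‖) ∧ ∀ (f : PairwiseGaussianRKHS X σ) (z : X × X),
        f z = inner ℝ (gaussFeature (feat σ (pairVal z) - feat σ c)) (J f) := by
  let Φ := fun z : (Fin d → ℝ) × (Fin d → ℝ) => gaussFeature (feat σ z - feat σ c)
  have hΦ : ∀ z w, inner ℝ (Φ z) (Φ w) = Real.exp (-(sqDist z w / σ ^ 2)) := fun z w => by
    simp only [Φ]
    rw [inner_gaussFeature, sub_sub_sub_cancel_right, norm_feat_sub]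
  let Ψ := fun z : X × X => (1 / 2 : ℝ) • (Φ (pairVal z) - Φ (pairVal z).swap)
  obtain ⟨J, hJ, hJ'⟩ := exists_feature_contraction (H := PairwiseGaussianRKHS X σ) Ψ
    (fun z w => by
      rw [kernel_pairwiseGaussianRKHS_apply]
      simp only [Ψ, inner_smul_left, inner_smul_right, inner_sub_left, inner_sub_right, hΦ,
        pairwiseGaussian, ← sqDist_swap_left, Prod.swap_swap]
      simp only [conj_trivial]
      ring)
  -- Evaluation is represented by the unsymmetrised `Φ z`, not by `Ψ z`: against the skew vectors `Ψ
  -- w` both give the kernel. Thus only `z`, and not `z.swap`, has to be close to `c`.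
  refine ⟨J, hJ, fun f z => hJ' z _ (fun w => ?_) f⟩
  rw [kernel_pairwiseGaussianRKHS_apply]
  change inner ℝ (Φ (pairVal z)) (Ψ w) = _
  simp only [Ψ, inner_smul_right, inner_sub_right, hΦ, pairwiseGaussian, ← sqDist_swap_left]
  ring

/-- Functions orthogonal to the Taylor coefficients of degree at most `N` at all pairs of centres
are uniformly small. -/
theorem exists_submodule_abs_le (hσ : 0 < σ) (T : Finset (Fin d → ℝ))
    (hT : ∀ x ∈ X, ∃ c ∈ T, dist x c ≤ σ) (N : ℕ) :
    ∃ V : Submodule ℝ (PairwiseGaussianRKHS X σ), FiniteDimensional ℝ V ∧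
      Module.finrank ℝ V ≤ T.card ^ 2 * (N + 2 * d).choose (2 * d) ∧
      ∀ f ∈ Vᗮ, ∀ z, |f z| ≤
        √(Real.exp (4 * d * (Real.exp 1 - 1) - (N + 1))) * ‖f‖ := by
  classical
  choose J hJ hJ' using exists_taylor X σ
  let b : (T × T) × (Σ k : Fin (N + 1),
      Finset.piAntidiag (Finset.univ : Finset (Fin d ⊕ Fin d)) (k : ℕ)) → PairwiseGaussianRKHS X σ :=
    -- Orthogonality of `f` to these vectors says that the coordinates of degree at most `N` of
    -- every `J (c₁, c₂) f` vanish.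
    fun q => (J (q.1.1, q.1.2)).adjoint (lp.single 2 (q.2.1 : ℕ) (EuclideanSpace.single q.2.2 1))
  refine ⟨Submodule.span ℝ (range b), FiniteDimensional.span_of_finite ℝ (finite_range b), ?_, ?_⟩
  · refine (finrank_range_le_card b).trans (le_of_eq ?_)
    simp only [Fintype.card_prod, Fintype.card_coe, Fintype.card_sigma, card_piAntidiag_univ,
      Fintype.card_sum, Fintype.card_fin, ← two_mul]
    rw [Fin.sum_univ_eq_sum_range fun k => (2 * d).multichoose k, Nat.sum_range_multichoose, sq]
  · intro f hf z
    obtain ⟨c₁, hc₁, h₁⟩ := hT _ z.1.2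
    obtain ⟨c₂, hc₂, h₂⟩ := hT _ z.2.2
    have hg : ∀ k ≤ N, J (c₁, c₂) f k = 0 := by
      intro k hk
      ext α
      have := Submodule.inner_right_of_mem_orthogonal (Submodule.subset_span (mem_range_self
        (((⟨c₁, hc₁⟩, ⟨c₂, hc₂⟩), ⟨⟨k, by omega⟩, α⟩) : (T × T) × (Σ k : Fin (N + 1),
          Finset.piAntidiag (Finset.univ : Finset (Fin d ⊕ Fin d)) (k : ℕ))))) hf
      simp only [b] at this
      rw [ContinuousLinearMap.adjoint_inner_left, lp.inner_single_left] at this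
      simpa [EuclideanSpace.inner_single_left] using this
    rw [hJ' (c₁, c₂) f z]
    refine (abs_inner_gaussFeature_le _ N _ hg).trans ?_
    refine mul_le_mul (Real.sqrt_le_sqrt (Real.exp_le_exp.mpr ?_)) (hJ _ f) (norm_nonneg _)
      (Real.sqrt_nonneg _)
    have := norm_feat_sub_sq_le hσ (pairVal z) (c₁, c₂) h₁ h₂
    have he : 0 ≤ Real.exp 1 - 1 := by
      have := Real.add_one_le_exp (1 : ℝ)
      linarith
    nlinarith [mul_le_mul_of_nonneg_right this he]

end PairwiseGaussian

/-! ### Numerical inequalities behind the constant -/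

section Numeric

lemma exp_one_bounds : 2.718 < Real.exp 1 ∧ Real.exp 1 < 2.7183 :=
  ⟨by linarith [Real.exp_one_gt_d9], by linarith [Real.exp_one_lt_d9]⟩

/-- The generalized binomial coefficient `binom(x + D, D)` as a product. -/
noncomputable def risingBinom (x : ℝ) (D : ℕ) : ℝ := ∏ j ∈ Finset.range D, (x + (j + 1)) / (j + 1)

lemma risingBinom_succ (x : ℝ) (D : ℕ) :
    risingBinom x (D + 1) = risingBinom x D * ((x + (D + 1)) / (D + 1)) :=
  Finset.prod_range_succ _ _

lemma one_le_risingBinom {x : ℝ} (hx : 0 ≤ x) (D : ℕ) : 1 ≤ risingBinom x D := by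
  induction D with
  | zero => simp [risingBinom]
  | succ D ih =>
    rw [risingBinom_succ]
    refine one_le_mul_of_one_le_of_one_le ih ?_
    rw [one_le_div₀ (by positivity)]
    linarith

lemma ringChoose_add_self (x : ℝ) (D : ℕ) : Ring.choose (x + D) D = risingBinom x D := by
  have h := Ring.factorial_nsmul_multichoose_eq_ascPochhammer (x + 1) D
  have h' : ∀ n : ℕ, (ascPochhammer ℝ n).eval (x + 1) = n.factorial * risingBinom x n := by
    intro n
    induction n with
    | zero => simp [risingBinom]
    | succ n ih =>
      rw [ascPochhammer_succ_eval, ih, risingBinom_succ, Nat.factorial_succ]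
      push_cast
      field_simp
      ring
  rw [Polynomial.ascPochhammer_smeval_eq_eval, h', nsmul_eq_mul] at h
  have hc : Ring.choose (x + D) D = Ring.multichoose (x + 1) D := by
    rw [Ring.choose, add_sub_cancel_right]
  rw [hc]
  exact mul_left_cancel₀ (Nat.cast_ne_zero.mpr D.factorial_ne_zero) h

lemma natCast_choose_add_self (N D : ℕ) : ((N + D).choose D : ℝ) = risingBinom N D := by
  rw [← ringChoose_add_self, ← Nat.cast_add, Ring.choose_natCast]

/-- The number of bits needed for a net of mesh comparable to `exp (-L)` in dimension `n`. -/
lemma four_div_pow_le {L : ℝ} (hL : 0 ≤ L) {n i : ℕ} (hi : 1 ≤ i)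
    (h : n * (2 + 1.5 * L) + 1 ≤ (i : ℝ)) : (4 / Real.exp (-L)) ^ n ≤ (2 : ℝ) ^ (i - 1) := by
  have h2 : (2 : ℝ) = Real.exp (Real.log 2) := (Real.exp_log (by norm_num)).symm
  have h4 : 4 / Real.exp (-L) = Real.exp (2 * Real.log 2 + L) := by
    rw [Real.exp_neg, div_inv_eq_mul, Real.exp_add, two_mul, Real.exp_add,
      Real.exp_log (by norm_num)]
    norm_num
  rw [h4, ← Real.exp_nat_mul]
  conv_rhs => rw [h2]
  rw [← Real.exp_nat_mul, Real.exp_le_exp, Nat.cast_sub hi, Nat.cast_one]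
  have hlog := Real.log_two_gt_d9
  have h₁ : 2 * Real.log 2 + L ≤ (2 + 1.5 * L) * Real.log 2 := by nlinarith
  calc (n : ℝ) * (2 * Real.log 2 + L) ≤ n * ((2 + 1.5 * L) * Real.log 2) :=
        mul_le_mul_of_nonneg_left h₁ (by positivity)
    _ = n * (2 + 1.5 * L) * Real.log 2 := by ring
    _ ≤ ((i : ℝ) - 1) * Real.log 2 := mul_le_mul_of_nonneg_right (by linarith) (by linarith)

/-- From `log q ≤ q - 1`. It shows that for `L ≤ D + 1` the worst exponent `q = 2 * p` in `(0, 1]`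
is `q = 1`. -/
lemma exp_mul_pow_le {L q : ℝ} {D : ℕ} (hL : L ≤ D + 1) (hq : 0 < q) (hq1 : q ≤ 1) :
    Real.exp L * q ^ (D + 1) ≤ Real.exp (q * L) := by
  have : q ^ (D + 1) = Real.exp ((D + 1 : ℕ) * Real.log q) := by
    rw [Real.exp_nat_mul, Real.exp_log hq]
  rw [this, ← Real.exp_add, Real.exp_le_exp]
  push_cast
  have hlog := Real.log_le_sub_one_of_pos hq
  nlinarith [mul_le_mul_of_nonneg_left hlog (by positivity : (0 : ℝ) ≤ D + 1),
    mul_nonneg (sub_nonneg.mpr hq1) (sub_nonneg.mpr hL)]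

/-- The power `D + 1` of `e * s ≤ exp s` at `s = t / (D + 1)`. With `t = 2 * p * L` it removes `p`
at fine scales. -/
lemma exp_one_mul_pow_le {t : ℝ} {D : ℕ} (ht : 0 ≤ t) :
    (Real.exp 1 * t) ^ (D + 1) ≤ (D + 1 : ℝ) ^ (D + 1) * Real.exp t := by
  have hD : (0 : ℝ) < D + 1 := by positivity
  have h : Real.exp 1 * (t / (D + 1)) ≤ Real.exp (t / (D + 1)) := by
    have := Real.add_one_le_exp (t / (D + 1) - 1)
    rw [Real.exp_sub, le_div_iff₀ (Real.exp_pos 1)] at this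
    linarith
  have h' := pow_le_pow_left₀ (by positivity) h (D + 1)
  rw [← Real.exp_nat_mul] at h'
  have ht' : ((D + 1 : ℕ) : ℝ) * (t / (D + 1)) = t := by
    push_cast
    field_simp
  rw [ht', ← mul_div_assoc, div_pow, div_le_iff₀ (by positivity)] at h'
  linarith

/-- The coarse-scale inequality at its endpoint `L = D + 1/2`, where `2 + 1.5 * L = 2.75 + 1.5 * D`.
Induction from `D = 2`: each step multiplies the right side by at least `3.7`, and the main term on
the left by at most `3.7`. -/
lemma small_scale_aux {D : ℕ} (hD : 2 ≤ D) :
    2 * (Real.exp 1 ^ D * Real.exp (1 / 2)) * (2.75 + 1.5 * D) + 1 ≤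
      12 * risingBinom (4 * Real.exp 1) D *
        ((D + 1) ^ (D + 1) / Real.exp 1 ^ (2 * D + 1)) := by
  obtain ⟨he, he'⟩ := exp_one_bounds
  set e := Real.exp 1 with hedef
  have hs : Real.exp (1 / 2) ^ 2 = e := by
    rw [← Real.exp_nat_mul]
    norm_num [hedef]
  set s := Real.exp (1 / 2)
  have hs0 : 0 < s := Real.exp_pos _
  induction D, hD using Nat.le_induction with
  | base =>
    have hs' : s < 1.6488 := by nlinarith
    have he2 : e ^ 2 < 7.3892 := by nlinarith
    have he5 : e ^ 5 < 148.44 := by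
      have : e ^ 5 ≤ 2.7183 ^ 5 := pow_le_pow_left₀ (by linarith) he'.le 5
      linarith [show (2.7183 : ℝ) ^ 5 < 148.44 by norm_num]
    have hB : risingBinom (4 * e) 2 = (4 * e + 1) * (4 * e + 2) / 2 := by
      simp [risingBinom, Finset.prod_range_succ]
      ring
    have hB' : 76.4 ≤ risingBinom (4 * e) 2 := by
      rw [hB]; nlinarith
    have hW : (27 / 148.44 : ℝ) ≤ ((2 : ℕ) + 1) ^ (2 + 1) / e ^ (2 * 2 + 1) := by
      rw [div_le_div_iff₀ (by norm_num) (by positivity)]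
      norm_num
      linarith
    have h1 : e ^ 2 * s ≤ 7.3892 * 1.6488 := mul_le_mul he2.le hs'.le hs0.le (by norm_num)
    have h2 := mul_le_mul hB' hW (by norm_num) (by linarith)
    push_cast at h2 ⊢
    norm_num at h1 h2 ⊢
    linarith
  | succ D hD ih =>
    have hDr : (2 : ℝ) ≤ D := by exact_mod_cast hD
    have hB : 0 < risingBinom (4 * e) D := (zero_lt_one).trans_le (one_le_risingBinom (by linarith) D)
    set R := 12 * risingBinom (4 * e) D * ((D + 1 : ℝ) ^ (D + 1) / e ^ (2 * D + 1)) with hR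
    have hR0 : 0 < R := by positivity
    have key : 3.7 * R ≤ 12 * risingBinom (4 * e) (D + 1) *
        (((D + 1 : ℕ) + 1 : ℝ) ^ (D + 1 + 1) / e ^ (2 * (D + 1) + 1)) := by
      have hbern : 2 * (D + 1 : ℝ) ^ (D + 1) ≤ (D + 2 : ℝ) ^ (D + 1) := by
        have h := one_add_mul_le_pow (a := 1 / (D + 1 : ℝ)) (by
          have : (0 : ℝ) < 1 / (D + 1) := by positivity
          linarith) (D + 1)
        have h1 : (1 : ℝ) + ((D + 1 : ℕ) : ℝ) * (1 / (D + 1)) = 2 := by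
          push_cast; field_simp; norm_num
        have h2 : (1 : ℝ) + 1 / (D + 1) = (D + 2) / (D + 1) := by field_simp; ring
        rw [h1, h2, div_pow, le_div_iff₀ (by positivity)] at h
        exact h
      have he2 : e ^ 2 < 7.3892 := by nlinarith
      have hfac : 3.7 * e ^ 2 ≤ 2 * ((D + 2) * ((4 * e + (D + 1)) / (D + 1))) := by
        rw [← mul_div_assoc, ← mul_div_assoc, le_div_iff₀ (by positivity)]
        have : 3.7 * e ^ 2 * (D + 1) ≤ 27.4 * (D + 1) := by
          apply mul_le_mul_of_nonneg_right _ (by positivity); linarith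
        nlinarith
      have hpow : e ^ (2 * (D + 1) + 1) = e ^ (2 * D + 1) * e ^ 2 := by ring
      rw [risingBinom_succ, hpow, hR, ← mul_div_assoc, ← mul_div_assoc, ← mul_div_assoc,
        div_le_div_iff₀ (by positivity) (by positivity)]
      push_cast
      have e1 : (D : ℝ) + 1 + 1 = D + 2 := by ring
      rw [e1, pow_succ ((D : ℝ) + 2)]
      have h3 : 3.7 * e ^ 2 * (D + 1 : ℝ) ^ (D + 1) ≤
          (D + 2) * ((4 * e + (D + 1)) / (D + 1)) * (D + 2 : ℝ) ^ (D + 1) :=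
        calc 3.7 * e ^ 2 * (D + 1 : ℝ) ^ (D + 1)
            ≤ 2 * ((D + 2) * ((4 * e + (D + 1)) / (D + 1))) * (D + 1 : ℝ) ^ (D + 1) :=
              mul_le_mul_of_nonneg_right hfac (by positivity)
          _ = ((D + 2) * ((4 * e + (D + 1)) / (D + 1))) * (2 * (D + 1 : ℝ) ^ (D + 1)) := by ring
          _ ≤ _ := mul_le_mul_of_nonneg_left hbern (by positivity)
      have h4 := mul_le_mul_of_nonneg_left h3
        (by positivity : 0 ≤ 12 * risingBinom (4 * e) D * e ^ (2 * D + 1))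
      linarith
    refine le_trans ?_ key
    refine le_trans ?_ (mul_le_mul_of_nonneg_left ih (by norm_num))
    push_cast
    rw [pow_succ]
    have h0 : 0 < e ^ D * s := by positivity
    have h5 : e * (2.75 + 1.5 * (D + 1)) ≤ 3.7 * (2.75 + 1.5 * D) := by nlinarith
    have h6 := mul_le_mul_of_nonneg_left h5 h0.le
    linarith

/-- The dimension count at scales `exp (-L)` with `L ≤ D + 1 / 2`. -/
lemma small_scale_bound {D : ℕ} (hD : 2 ≤ D) {L : ℝ} (hL0 : 0 ≤ L) (hL : L ≤ D + 1 / 2) :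
    2 * Real.exp L ^ 2 * (2 + 1.5 * L) + 1 ≤ 12 * risingBinom (4 * Real.exp 1) D *
      ((D + 1) ^ (D + 1) / Real.exp 1 ^ (2 * D + 1)) * Real.exp L := by
  have h := small_scale_aux hD
  have h1 : Real.exp L ≤ Real.exp 1 ^ D * Real.exp (1 / 2) := by
    rw [← Real.exp_nat_mul, ← Real.exp_add, Real.exp_le_exp]
    linarith
  have h2 : 1 ≤ Real.exp L := Real.one_le_exp hL0
  have h3 : Real.exp L * (2 + 1.5 * L) ≤
      Real.exp 1 ^ D * Real.exp (1 / 2) * (2.75 + 1.5 * D) :=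
    mul_le_mul h1 (by linarith) (by positivity) (by positivity)
  have h4 : 2 * Real.exp L * (2 + 1.5 * L) + 1 ≤ 12 * risingBinom (4 * Real.exp 1) D *
      ((D + 1) ^ (D + 1) / Real.exp 1 ^ (2 * D + 1)) := by linarith
  have h5 := mul_le_mul_of_nonneg_right h4 (Real.exp_pos L).le
  linarith

/-- The factors exceed one only for `j ≤ 5`, so the product peaks at `D = 6`. -/
lemma prod_ratio_le (D : ℕ) :
    ∏ j ∈ Finset.range D, (17.5 / (11.872 + j) : ℝ) ≤ 3.5 := by
  have hpos : ∀ n, 0 ≤ ∏ j ∈ Finset.range n, (17.5 / (11.872 + j) : ℝ) := fun n =>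
    Finset.prod_nonneg fun j _ => by positivity
  rcases le_or_gt D 6 with hD | hD
  · interval_cases D <;> norm_num [Finset.prod_range_succ]
  · induction D, hD.le using Nat.le_induction with
    | base => norm_num [Finset.prod_range_succ]
    | succ D hD' ih =>
      rw [Finset.prod_range_succ]
      have h1 : (17.5 / (11.872 + D) : ℝ) ≤ 1 := by
        rw [div_le_one (by positivity)]
        have : (6 : ℝ) ≤ D := by exact_mod_cast hD'
        linarith
      have h2 : ∏ j ∈ Finset.range D, (17.5 / (11.872 + j) : ℝ) ≤ 3.5 := by
        rcases hD'.eq_or_lt with rfl | h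
        · norm_num [Finset.prod_range_succ]
        · exact ih h
      exact (mul_le_of_le_one_right (hpos D) h1).trans h2

lemma risingBinom_le {D : ℕ} {L x : ℝ} (hx0 : 0 ≤ x) (hL : D + 1 / 2 ≤ L)
    (hx : x ≤ 2 * L + 2 * D * (Real.exp 1 - 1) + 2 * Real.log 2) :
    risingBinom x D ≤ 3.5 * (risingBinom (4 * Real.exp 1) D * (L / Real.exp 1) ^ D) := by
  obtain ⟨he, he'⟩ := exp_one_bounds
  have hlog := Real.log_two_lt_d9
  set e := Real.exp 1
  have hL0 : 0 < L := lt_of_lt_of_le (by positivity) hL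
  have hfac : ∀ j ∈ Finset.range D, (x + (j + 1)) / (j + 1 : ℝ) ≤
      17.5 / (11.872 + j) * ((4 * e + (j + 1)) / (j + 1) * (L / e)) := fun j hj => by
    have hj' : (j : ℝ) + 1 ≤ D := by exact_mod_cast Finset.mem_range.mp hj
    -- Uses `j + 1 ≤ D ≤ L - 1/2`; the spare `(2 * e - 1) / 2` absorbs `2 * log 2`. Below, `11.872 =
    -- 4 * 2.718 + 1`.
    have h1 : x + (j + 1) ≤ (2 * e + 1) * L := by nlinarith
    have h2 : e * (2 * e + 1) ≤ 17.5 := by nlinarith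
    have h3 : 11.872 + (j : ℝ) ≤ 4 * e + (j + 1) := by linarith
    have h4 : (2 * e + 1) * L ≤ 17.5 / (11.872 + j) * ((4 * e + (j + 1)) * (L / e)) := by
      have h5 : 17.5 ≤ 17.5 / (11.872 + j) * (4 * e + (j + 1)) := by
        rw [div_mul_eq_mul_div, le_div_iff₀ (by positivity)]
        linarith
      calc (2 * e + 1) * L = e * (2 * e + 1) * (L / e) := by field_simp
        _ ≤ 17.5 / (11.872 + j) * (4 * e + (j + 1)) * (L / e) :=
          mul_le_mul_of_nonneg_right (h2.trans h5) (by positivity)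
        _ = _ := by ring
    calc (x + (j + 1)) / (j + 1 : ℝ)
        ≤ 17.5 / (11.872 + j) * ((4 * e + (j + 1)) * (L / e)) / (j + 1) :=
          div_le_div_of_nonneg_right (h1.trans h4) (by positivity)
      _ = _ := by ring
  have h := Finset.prod_le_prod (fun j _ => by positivity) hfac
  rw [Finset.prod_mul_distrib, Finset.prod_mul_distrib, Finset.prod_const, Finset.card_range] at h
  refine h.trans (mul_le_mul_of_nonneg_right (prod_ratio_le D) ?_)
  exact mul_nonneg (zero_le_one.trans (one_le_risingBinom (by linarith) D)) (by positivity)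

/-- The dimension count at scales `exp (-L)` with `D + 1 / 2 ≤ L`. -/
lemma large_scale_bound {D : ℕ} (hD : 2 ≤ D) {L x M : ℝ} (hL : D + 1 / 2 ≤ L) (hM : 1 ≤ M)
    (hx0 : 0 ≤ x) (hx : x ≤ 2 * L + 2 * D * (Real.exp 1 - 1) + 2 * Real.log 2) :
    M * risingBinom x D * (2 + 1.5 * L) + 1 ≤
      12 * risingBinom (4 * Real.exp 1) D * M * (L ^ (D + 1) / Real.exp 1 ^ D) := by
  have h := risingBinom_le hx0 hL hx
  have h1 := one_le_risingBinom hx0 D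
  have hDr : (2 : ℝ) ≤ D := by exact_mod_cast hD
  have hL' : 2.5 ≤ L := by linarith
  set Y := risingBinom (4 * Real.exp 1) D * (L / Real.exp 1) ^ D with hY
  have hr : 12 * risingBinom (4 * Real.exp 1) D * M * (L ^ (D + 1) / Real.exp 1 ^ D) =
      12 * (M * Y * L) := by
    rw [hY, div_pow]; ring
  rw [hr]
  have hY0 : 1 / 3.5 ≤ Y := by rw [div_le_iff₀ (by norm_num)]; linarith
  -- Since `L ≥ 2.5`, `2 + 1.5 * L ≤ 2.3 * L`. As `3.5 * 2.3 < 12`, the remaining multiple of `M * Y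
  -- * L` absorbs the `+ 1`.
  have h2 : M * risingBinom x D * (2 + 1.5 * L) ≤ M * (3.5 * Y) * (2.3 * L) :=
    mul_le_mul (mul_le_mul_of_nonneg_left h (by linarith)) (by linarith) (by positivity)
      (by positivity)
  have h3 : 1 * (1 / 3.5) * 2.5 ≤ M * Y * L :=
    mul_le_mul (mul_le_mul hM hY0 (by norm_num) (by linarith)) hL' (by norm_num) (by positivity)
  norm_num at h3
  linarith

end Numeric

/-! ### Entropy bound for an arbitrary probability measure -/

section EntropyBound

variable {d : ℕ} {X : Set (Fin d → ℝ)} {C ϱ σ p : ℝ}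

lemma BoxCountingCondition.exists_finset_cover (hX : BoxCountingCondition X C ϱ) (hσ : 0 < σ)
    (hσ1 : σ ≤ 1) : ∃ T : Finset (Fin d → ℝ), (T.card : ℝ) ≤ C * σ ^ (-ϱ) ∧
      ∀ x ∈ X, ∃ c ∈ T, dist x c ≤ σ := by
  obtain ⟨hC, -, h⟩ := hX
  lift σ to ℝ≥0 using hσ.le
  have hcov := h σ (by exact_mod_cast hσ) (by exact_mod_cast hσ1)
  have hne : Metric.coveringNumber σ X ≠ ⊤ := by
    intro htop
    simp [htop] at hcov
  obtain ⟨T, -, hfin, hT, hcard⟩ := Metric.exists_set_encard_eq_coveringNumber hne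
  refine ⟨hfin.toFinset, ?_, fun x hx => ?_⟩
  · rw [← hcard, hfin.encard_eq_coe_toFinset_card] at hcov
    have h0 : 0 ≤ C * (σ : ℝ) ^ (-ϱ) := mul_nonneg (by linarith) (by positivity)
    have := ENNReal.toReal_le_of_le_ofReal h0 hcov
    simpa using this
  · obtain ⟨c, hc, hxc⟩ := hT hx
    refine ⟨c, by simpa using hc, ?_⟩
    have hxc' : edist x c ≤ σ := hxc
    rw [edist_nndist] at hxc'
    exact_mod_cast hxc'

lemma eLpNorm_le_of_abs_le {μ : Measure (X × X)} [IsProbabilityMeasure μ]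
    {f : X × X → ℝ} {b : ℝ} (h : ∀ z, |f z| ≤ b) : eLpNorm f 2 μ ≤ ENNReal.ofReal b := by
  refine (eLpNorm_le_of_ae_bound (C := b) (.of_forall h)).trans ?_
  simp

lemma entropyNumberId_le_of_forall {μ : Measure (X × X)} [IsProbabilityMeasure μ] {ε : ℝ}
    (hε : 0 < ε) (h : ∀ f : PairwiseGaussianRKHS X σ, ‖f‖ ≤ 1 → ∀ z, |f z| ≤ ε) (i : ℕ) :
    entropyNumberId (PairwiseGaussianRKHS X σ) μ i ≤ ENNReal.ofReal ε := by
  refine entropyNumberId_le_of_finset hε {0} (by simp) (by simpa using Nat.one_le_two_pow)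
    fun f hf => ⟨0, by simp, ?_⟩
  rw [sub_zero]
  exact eLpNorm_le_of_abs_le (h f hf)

/-- Entropy bound from a subspace capturing all of `L₂(μ)` up to `exp (-L) / 2`. -/
lemma entropyNumberId_le_of_trace {μ : Measure (X × X)} [IsProbabilityMeasure μ] {L : ℝ}
    (hL : 0 ≤ L) {i : ℕ} (hi : 1 ≤ i)
    (h : 2 * Real.exp L ^ 2 * (2 + 1.5 * L) + 1 ≤ i) :
    entropyNumberId (PairwiseGaussianRKHS X σ) μ i ≤ ENNReal.ofReal (Real.exp (-L)) := by
  have hmeas : ∀ f : PairwiseGaussianRKHS X σ, AEStronglyMeasurable (f : X × X → ℝ) μ :=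
    fun f => (continuous_coe f).aestronglyMeasurable
  obtain ⟨V, hfin, hdim, hV⟩ := exists_submodule_eLpNorm_orthogonal_le hmeas abs_apply_le
    (half_pos (Real.exp_pos (-L)))
  refine entropyNumberId_le_of_orthogonal hmeas abs_apply_le V (Real.exp_pos _)
    (Real.exp_le_one_iff.mpr (by linarith)) hV (four_div_pow_le hL hi ?_)
  have hdim' : (Module.finrank ℝ V : ℝ) ≤ 2 * Real.exp L ^ 2 := by
    refine hdim.trans (le_of_eq ?_)
    rw [Real.exp_neg]
    field_simp
  have := mul_le_mul_of_nonneg_right hdim' (by linarith : 0 ≤ 2 + 1.5 * L)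
  linarith

/-- Entropy bound from the Taylor coefficients at the centres of a cover of `X`. -/
lemma entropyNumberId_le_of_cover {μ : Measure (X × X)} [IsProbabilityMeasure μ] (hσ : 0 < σ)
    (T : Finset (Fin d → ℝ)) (hT : ∀ x ∈ X, ∃ c ∈ T, dist x c ≤ σ) {N : ℕ} {L : ℝ}
    (hL : 0 ≤ L) (hN : 2 * L + 4 * d * (Real.exp 1 - 1) + 2 * Real.log 2 ≤ N + 1)
    {i : ℕ} (hi : 1 ≤ i)
    (h : (T.card : ℝ) ^ 2 * (N + 2 * d).choose (2 * d) * (2 + 1.5 * L) + 1 ≤ i) :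
    entropyNumberId (PairwiseGaussianRKHS X σ) μ i ≤ ENNReal.ofReal (Real.exp (-L)) := by
  obtain ⟨V, hfin, hdim, hV⟩ := exists_submodule_abs_le hσ T hT N
  refine entropyNumberId_le_of_orthogonal (fun f => (continuous_coe f).aestronglyMeasurable)
    abs_apply_le V (Real.exp_pos _) (Real.exp_le_one_iff.mpr (by linarith))
    (fun f hf hf1 => eLpNorm_le_of_abs_le fun z => ?_) (four_div_pow_le hL hi ?_)
  · refine (hV f hf z).trans ((mul_le_of_le_one_right (Real.sqrt_nonneg _) hf1).trans ?_)
    refine Real.sqrt_le_iff.mpr ⟨by positivity, ?_⟩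
    have h4 : (Real.exp (-L) / 2) ^ 2 = Real.exp (-(2 * L) - 2 * Real.log 2) := by
      rw [Real.exp_sub, two_mul (Real.log 2), Real.exp_add, Real.exp_log (by norm_num), div_pow,
        ← Real.exp_nat_mul]
      norm_num
    rw [h4, Real.exp_le_exp]
    linarith
  · have hdim' : (Module.finrank ℝ V : ℝ) ≤ (T.card : ℝ) ^ 2 * (N + 2 * d).choose (2 * d) := by
      exact_mod_cast hdim
    have := mul_le_mul_of_nonneg_right hdim' (by linarith : 0 ≤ 2 + 1.5 * L)
    linarith

lemma ringChoose_four_exp (d : ℕ) : Ring.choose (4 * Real.exp 1 + 2 * d) (2 * d) =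
    risingBinom (4 * Real.exp 1) (2 * d) := by
  rw [← ringChoose_add_self]
  push_cast
  rfl

/-- The factor `2 ^ (2d + 1)` in the denominator of `cStar` pairs with `p ^ (2d + 1)`, so
multiplying by `(2 * p) ^ (2d + 1)` leaves no `p`. -/
lemma capacity_base_eq (hσ : 0 < σ) (hp : 0 < p) :
    cStar d C * p ^ (-(2 * (d : ℝ) + 1)) * σ ^ (-(2 * ϱ)) * (2 * p) ^ (2 * d + 1) =
      12 * risingBinom (4 * Real.exp 1) (2 * d) *
        (((2 * d : ℕ) + 1 : ℝ) ^ (2 * d + 1) / Real.exp 1 ^ (2 * (2 * d) + 1)) *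
        (C * σ ^ (-ϱ)) ^ 2 := by
  have h1 : p ^ (-(2 * (d : ℝ) + 1)) = (p ^ (2 * d + 1))⁻¹ := by
    rw [Real.rpow_neg hp.le, ← Real.rpow_natCast]
    push_cast
    rfl
  have h2 : σ ^ (-(2 * ϱ)) = (σ ^ (-ϱ)) ^ 2 := by
    rw [← Real.rpow_mul_natCast hσ.le]
    congr 1
    push_cast
    ring
  have h3 : Real.exp (4 * d + 1) = Real.exp 1 ^ (2 * (2 * d) + 1) := by
    rw [← Real.exp_nat_mul]
    push_cast
    ring_nf
  rw [cStar, h1, h2, h3, ringChoose_four_exp, mul_pow, mul_pow]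
  push_cast
  field_simp

lemma cStar_pos (hC : 1 ≤ C) : 0 < cStar d C := by
  have := one_le_risingBinom (by positivity : 0 ≤ 4 * Real.exp 1) (2 * d)
  rw [cStar, ringChoose_four_exp]
  positivity

lemma capacityConst_pos (hC : 1 ≤ C) (hσ : 0 < σ) (hp : 0 < p) : 0 < capacityConst d C ϱ σ p := by
  have := cStar_pos (d := d) hC
  rw [capacityConst]
  positivity

theorem entropyNumberId_le (hX : BoxCountingCondition X C ϱ) (hσ : 0 < σ) (hσ1 : σ ≤ 1)
    (hp : 0 < p) (hp2 : p < 1 / 2) (μ : Measure (X × X)) [IsProbabilityMeasure μ] {i : ℕ}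
    (hi : 1 ≤ i) : entropyNumberId (PairwiseGaussianRKHS X σ) μ i ≤
      ENNReal.ofReal (capacityConst d C ϱ σ p * (i : ℝ) ^ (-(1 / (2 * p)))) := by
  have hir : (0 : ℝ) < i := by exact_mod_cast hi
  set ε := capacityConst d C ϱ σ p * (i : ℝ) ^ (-(1 / (2 * p))) with hεdef
  have hε : 0 < ε := mul_pos (capacityConst_pos hX.1 hσ hp) (by positivity)
  rcases Nat.eq_zero_or_pos d with rfl | hd
  · exact entropyNumberId_le_of_forall hε
      (fun f _ z => by rw [apply_eq_zero_of_dim_zero, abs_zero]; exact hε.le) i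
  -- For `ε ≥ 1` the single centre `0` suffices, as `|f z| ≤ 1 / √2` on the unit ball.
  rcases le_or_gt 1 ε with hε1 | hε1
  · refine entropyNumberId_le_of_forall hε (fun f hf z => (abs_apply_le f z).trans ?_) i
    rw [div_le_iff₀ (by positivity)]
    have : 1 ≤ √2 := Real.one_le_sqrt.mpr (by norm_num)
    nlinarith
  set A := cStar d C * p ^ (-(2 * (d : ℝ) + 1)) * σ ^ (-(2 * ϱ)) with hA
  have hA0 : 0 < A := by
    have := cStar_pos (d := d) hX.1
    positivity
  set L := -Real.log ε with hLdef
  have hL : 0 < L := neg_pos.mpr (Real.log_neg hε hε1)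
  have hεL : ε = Real.exp (-L) := by rw [hLdef, neg_neg, Real.exp_log hε]
  -- The definition of `ε` solved for `i`: the available number of bits in terms of the scale.
  have hiA : A * Real.exp (2 * p * L) = i := by
    have hlog : 2 * p * L = Real.log i - Real.log A := by
      rw [hLdef, hεdef, capacityConst, ← hA, Real.log_mul (by positivity) (by positivity),
        Real.log_rpow hA0, Real.log_rpow hir]
      field_simp
      ring
    rw [hlog, Real.exp_sub, Real.exp_log hir, Real.exp_log hA0]
    field_simp
  set D := 2 * d with hD
  have hD2 : 2 ≤ D := by omega
  have hq : 0 < 2 * p := by linarith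
  set B := risingBinom (4 * Real.exp 1) D with hB
  have hB1 : 1 ≤ B := one_le_risingBinom (by positivity) D
  set M := (C * σ ^ (-ϱ)) ^ 2 with hM
  have hM1 : 1 ≤ M := by
    refine one_le_pow₀ (one_le_mul_of_one_le_of_one_le hX.1 ?_)
    exact Real.one_le_rpow_of_pos_of_le_one_of_nonpos hσ hσ1 (by linarith [hX.2.1])
  have hbase : A * (2 * p) ^ (D + 1) =
      12 * B * (((D : ℝ) + 1) ^ (D + 1) / Real.exp 1 ^ (2 * D + 1)) * M :=
    capacity_base_eq hσ hp
  have hiq : (i : ℝ) * (2 * p) ^ (D + 1) =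
      12 * B * (((D : ℝ) + 1) ^ (D + 1) / Real.exp 1 ^ (2 * D + 1)) * M *
        Real.exp (2 * p * L) := by
    rw [← hiA, ← hbase]; ring
  rw [hεL]
  rcases le_total L (D + 1 / 2) with hLD | hLD
  · refine entropyNumberId_le_of_trace hL.le hi ((small_scale_bound hD2 hL.le hLD).trans ?_)
    rw [← mul_le_mul_iff_left₀ (pow_pos hq (D + 1)), hiq]
    have h1 := exp_mul_pow_le (D := D) (by linarith : L ≤ D + 1) hq (by linarith)
    set W := 12 * B * (((D : ℝ) + 1) ^ (D + 1) / Real.exp 1 ^ (2 * D + 1)) with hW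
    have hW0 : 0 < W := by positivity
    calc W * Real.exp L * (2 * p) ^ (D + 1) = W * 1 * (Real.exp L * (2 * p) ^ (D + 1)) := by ring
      _ ≤ W * M * Real.exp (2 * p * L) := by gcongr
  · obtain ⟨T, hTcard, hT⟩ := hX.exists_finset_cover hσ hσ1
    have hTM : (T.card : ℝ) ^ 2 ≤ M := pow_le_pow_left₀ (Nat.cast_nonneg _) hTcard 2
    have he := exp_one_bounds.1
    have hx0 : 0 ≤ 2 * L + 2 * D * (Real.exp 1 - 1) + 2 * Real.log 2 := by
      have := Real.log_two_gt_d9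
      have : 0 ≤ 2 * (D : ℝ) * (Real.exp 1 - 1) :=
        mul_nonneg (mul_nonneg zero_le_two (Nat.cast_nonneg D)) (by linarith)
      linarith
    set N := ⌊2 * L + 2 * D * (Real.exp 1 - 1) + 2 * Real.log 2⌋₊
    have hDd : (D : ℝ) = 2 * d := by rw [hD]; push_cast; rfl
    refine entropyNumberId_le_of_cover (N := N) hσ T hT hL.le ?_ hi ?_
    · have h1 : 2 * L + 2 * D * (Real.exp 1 - 1) + 2 * Real.log 2 < (N : ℝ) + 1 :=
        Nat.lt_floor_add_one _
      have h2 : 2 * (D : ℝ) * (Real.exp 1 - 1) = 4 * d * (Real.exp 1 - 1) := by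
        rw [hDd]; ring
      linarith
    · rw [natCast_choose_add_self]
      have h1 := large_scale_bound hD2 hLD hM1 (Nat.cast_nonneg N) (Nat.floor_le hx0)
      have h2 : (T.card : ℝ) ^ 2 * risingBinom N D * (2 + 1.5 * L) ≤
          M * risingBinom N D * (2 + 1.5 * L) := by
        have := one_le_risingBinom (Nat.cast_nonneg N) D
        gcongr
      refine (add_le_add_left h2 1).trans (h1.trans ?_)
      rw [← mul_le_mul_iff_left₀ (pow_pos hq (D + 1)), hiq]
      have h3 := exp_one_mul_pow_le (t := 2 * p * L) (D := D) (by positivity)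
      have hexp : Real.exp 1 ^ (2 * D + 1) = Real.exp 1 ^ D * Real.exp 1 ^ (D + 1) := by ring
      have h4 : L ^ (D + 1) / Real.exp 1 ^ D * (2 * p) ^ (D + 1) ≤
          ((D : ℝ) + 1) ^ (D + 1) / Real.exp 1 ^ (2 * D + 1) * Real.exp (2 * p * L) := by
        rw [hexp, div_mul_eq_mul_div, div_mul_eq_mul_div, div_le_div_iff₀ (by positivity)
          (by positivity)]
        rw [mul_pow, mul_pow] at h3
        have h5 := mul_le_mul_of_nonneg_left h3 (by positivity : 0 ≤ Real.exp 1 ^ D)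
        linarith
      have h6 := mul_le_mul_of_nonneg_left h4 (by positivity : 0 ≤ 12 * B * M)
      linarith

end EntropyBound

/-! ### The empirical measures are probability measures -/

section Empirical

variable {Ω : Type*} [MeasurableSpace Ω]

lemma isProbabilityMeasure_empiricalMeasure {n : ℕ} (hn : 1 ≤ n) (x : Fin n → Ω) :
    IsProbabilityMeasure (empiricalMeasure x) := by
  refine ⟨?_⟩
  have hn0 : (n : ℝ≥0∞) ≠ 0 := by exact_mod_cast (by omega : n ≠ 0)
  simp [empiricalMeasure, ENNReal.inv_mul_cancel hn0 (ENNReal.natCast_ne_top n)]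

lemma isProbabilityMeasure_empiricalPairMeasure {n : ℕ} (hn : 2 ≤ n) (x : Fin n → Ω) :
    IsProbabilityMeasure (empiricalPairMeasure x) := by
  refine ⟨?_⟩
  have hn0 : ((n * (n - 1) : ℕ) : ℝ≥0∞) ≠ 0 := by
    exact_mod_cast (Nat.mul_pos (by omega) (by omega) : 0 < n * (n - 1)).ne'
  have h := ENNReal.inv_mul_cancel hn0 (ENNReal.natCast_ne_top _)
  rw [Nat.cast_mul] at h
  simpa [empiricalPairMeasure, Finset.card_erase_of_mem] using h

end Empirical

end PairwiseRanking

theorem mainTheorem5 {d : ℕ} (X : Set (Fin d → ℝ)) (C ϱ : ℝ)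
    (hX : PairwiseRanking.BoxCountingCondition X C ϱ)
    (P : MeasureTheory.Measure X) [MeasureTheory.IsProbabilityMeasure P]
    (σ : ℝ) (hσ : 0 < σ) (hσ1 : σ ≤ 1) (p : ℝ) (hp : 0 < p) (hp2 : p < 1 / 2) :
    PairwiseRanking.CapacityCondition (PairwiseRanking.PairwiseGaussianRKHS X σ) P p p
      (PairwiseRanking.capacityConst d C ϱ σ p) (PairwiseRanking.capacityConst d C ϱ σ p) := by
  have hmem : ∀ (μ : MeasureTheory.Measure (X × X)) [MeasureTheory.IsProbabilityMeasure μ]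
      (f : PairwiseRanking.PairwiseGaussianRKHS X σ),
      MeasureTheory.MemLp (f : X × X → ℝ) 2 μ := fun μ _ f =>
    MeasureTheory.MemLp.of_bound (PairwiseRanking.continuous_coe f).aestronglyMeasurable
      (‖f‖ / √2) (.of_forall fun z => PairwiseRanking.abs_apply_le f z)
  have hpos := PairwiseRanking.capacityConst_pos (d := d) (ϱ := ϱ) hX.1 hσ hp
  refine ⟨⟨hp, hp2⟩, ⟨hp, hp2⟩, hpos, hpos, fun n hn x f => ?_, fun n hn x f => ?_,
    fun n hn x i hi => ?_, fun n hn x i hi => ?_⟩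
  · have := PairwiseRanking.isProbabilityMeasure_empiricalMeasure hn x
    exact hmem _ f
  · have := PairwiseRanking.isProbabilityMeasure_empiricalPairMeasure hn x
    exact hmem _ f
  · have := PairwiseRanking.isProbabilityMeasure_empiricalMeasure hn x
    exact PairwiseRanking.entropyNumberId_le hX hσ hσ1 hp hp2 _ hi
  · have := PairwiseRanking.isProbabilityMeasure_empiricalPairMeasure hn x
    exact PairwiseRanking.entropyNumberId_le hX hσ hσ1 hp hp2 _ hi
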